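/- **Setting.** Let $q\ge 1$ be an integer, $\mathbb S^q\subset\mathbb R^{q+1}$ the unit sphere, $\mu_q$ its surface measure normalized to $\mu_q(\mathbb S^q)=1$, and $\|\cdot\|_p$ the norm of $L^p(\mu_q)$. Let $\Pi_n^q$ be the space of restrictions to $\mathbb S^q$ of polynomials in $q+1$ variables of degree at most $n$, and $\mathbf H_\ell^q$ the space of restrictions to $\mathbb S^q$ of homogeneous harmonic polynomials of degree $\ell$. Put $d^q_0=1$ and $d^q_\ell=\frac{2\ell+q-1}{\ell+q-1}\binom{\ell+q-1}{\ell}$ for $\ell\ge1$ (so $d_\ell^q=\dim\mathbf H^q_\ell$ and $d_n^{q+1}=\dim\Pi_n^q$). Let $y_1,y_2,\dots$ be a sequence of spherical harmonics, orthonormal in $L^2(\mu_q)$ and containing a basis of each $\mathbf H^q_\ell$, with $y_1\equiv1$ and with lower degrees listed before higher ones. For a finite measure $\nu$ supported on a finite set $\mathcal C\subset\mathbb S^q$ put $v_\xi=\nu(\{\xi\})$, and for $N=d_n^{q+1}$ let $G_N=\big(\int y_jy_k\,d\nu\big)_{j,k=1}^N$ be the Gram matrix. When $G_N$ is invertible,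 let $w_\xi^{LSQ}=v_\xi\sum_{k=1}^N (G_N^{-1})_{1,k}\,y_k(\xi)$, $\xi\in\mathcal C$. For $c_1,c_2>0$ and $1\le p\le\infty$ consider the two-sided Marcinkiewicz–Zygmund (M–Z) inequalities $$c_1\|P\|_p\le\Big\{\sum_{\xi\in\mathcal C}v_\xi|P(\xi)|^p\Big\}^{1/p}\le c_2\|P\|_p,\qquad P\in\Pi_n^q, \tag{1}$$ where for $p=\infty$ the middle term means $\max_{\xi\in\mathcal C}|P(\xi)|$. **Theorem.** Let $n\ge1$ be an integer, $N=d_n^{q+1}$, and let $\mathcal C$, $\nu$, $v_\xi$ be as above. (a) If (1) holds for $p=2$ with constants $c_1,c_2$, then all eigenvalues of $G_N$ lie in $[c_1^2,c_2^2]$; in particular, $G_N$ is positive definite. If (1) holds for all $1\le p\le\infty$ with the same $c_1,c_2$, then $\sum_{\xi\in\mathcal C}|w_\xi^{LSQ}|\le c$, where $c$ depends only on $q,c_1,c_2$. (b) Suppose that (1) holds for all $1\le p\le\infty$ and that, for some $\kappa>0$, $$\Big|\int P^2d\nu-\int P^2d\mu_q\Big|\le\frac{\kappa}{n^q}\int P^2d\mu_q,\qquad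 P\in\Pi_n^q. \tag{2}$$ Then there is a constant $c$ depending only on $q,c_1,c_2,\kappa$ such that $|w_\xi^{LSQ}|\le c\,v_\xi$ for all $\xi\in\mathcal C$, and the weights satisfy the M–Z condition $\big(\sum_{\xi\in\mathcal C}|w^{LSQ}_\xi||P(\xi)|^p\big)^{1/p}\le c\|P\|_p$ for all $P\in\Pi_n^q$ and $1\le p<\infty$. (c) There is a constant $c_1>0$ depending only on $q$ such that for every $A>0$ the following holds. There is a constant $c=c(q,A)>0$ such that if $\eta>0$ is real, $n\ge2$ and $M\ge1$ are integers with $M\ge c\,n^q\log n\,\max(1,\eta^{-2})$, the points $\xi_1,\dots,\xi_M$ are independent and distributed according to $\mu_q$, and $\nu$ associates the mass $1/M$ with each $\xi_j$, then $$\mathrm{Prob}\Big(\Big|\int P^2d\nu-\int P^2d\mu_q\Big|\ge\eta\int P^2d\mu_q\ \text{ for some } P\in\Pi_n^q,\ P\not\equiv0\Big)\le c_1n^{-A}.$$ In particular, for every $\kappa>0$ there is $c'=c'(q,A,\kappa)>0$ such that if $n\ge 2$ and $M\ge c'n^{3q}\log n$, then (2) holds for this $\nu$ with probability exceeding $1-c_1n^{-A}$.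 -/

import Mathlib

open MeasureTheory

noncomputable section

/-- The unit sphere `𝕊^q` of the Euclidean space `ℝ^(q+1)`. -/
abbrev Sph (q : ℕ) : Type :=
  Metric.sphere (0 : EuclideanSpace ℝ (Fin (q + 1))) 1

/-- The surface measure on `𝕊^q`, normalized to total mass one. -/
def muSph (q : ℕ) : Measure (Sph q) :=
  ((volume : Measure (EuclideanSpace ℝ (Fin (q + 1)))).toSphere Set.univ)⁻¹ •
    (volume : Measure (EuclideanSpace ℝ (Fin (q + 1)))).toSphere

/-- The value at a point of the sphere of a polynomial in `q + 1` variables. -/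
def evalSph {q : ℕ} (p : MvPolynomial (Fin (q + 1)) ℝ) (x : Sph q) : ℝ :=
  MvPolynomial.eval (fun i => x.1 i) p

/-- `Π_n^q`: spherical polynomials of degree at most `n`, as functions on the sphere. -/
def PiSph (q n : ℕ) : Set (Sph q → ℝ) :=
  {f | ∃ p : MvPolynomial (Fin (q + 1)) ℝ, p.totalDegree ≤ n ∧ f = evalSph p}

/-- `H_ℓ^q`: restrictions to the sphere of the homogeneous harmonic polynomials of degree `ℓ`. -/
def HarmSph (q l : ℕ) : Set (Sph q → ℝ) :=
  {f | ∃ p : MvPolynomial (Fin (q + 1)) ℝ, p.IsHomogeneous l ∧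
    ∑ i, MvPolynomial.pderiv i (MvPolynomial.pderiv i p) = 0 ∧ f = evalSph p}

/-- The number `d_ℓ^q = (2ℓ+q-1)/(ℓ+q-1) * binom(ℓ+q-1, ℓ)` for `ℓ ≥ 1`, and `d_0^q = 1`
(used for `q ≥ 1`; the division is exact). -/
def harmDim (q l : ℕ) : ℕ :=
  if l = 0 then 1 else (2 * l + q - 1) * (l + q - 1).choose l / (l + q - 1)

/-- `y 0, y 1, …` is an enumeration of spherical harmonics that are orthonormal in `L²(μ_q)` and
contain a basis of every `H_ℓ^q`; it starts with the constant function `1`, and lower degrees are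
listed before higher ones (`deg k` is the degree of `y k`). -/
structure IsHarmonicBasis (q : ℕ) (deg : ℕ → ℕ) (y : ℕ → Sph q → ℝ) : Prop where
  mem : ∀ k, y k ∈ HarmSph q (deg k)
  mono : Monotone deg
  first : ∀ x, y 0 x = 1
  orthonormal : ∀ j k, ∫ x, y j x * y k x ∂(muSph q) = if j = k then 1 else 0
  spans : ∀ l, ∀ f ∈ HarmSph q l, f ∈ Submodule.span ℝ (y '' {k | deg k = l})

/-- The Gram matrix `G_N` of the first `N` functions in `L²(ν)`. -/
def gramMat {q : ℕ} (y : ℕ → Sph q → ℝ) (ν : Measure (Sph q)) (N : ℕ) :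
    Matrix (Fin N) (Fin N) ℝ :=
  Matrix.of fun j k => ∫ x, y j x * y k x ∂ν

/-- The least squares weight `w_ξ = ν({ξ}) ∑ b_k y_k(ξ)`, where `b = G_N⁻¹ (1, 0, …, 0)ᵀ`. -/
def lsqWeight {q : ℕ} (y : ℕ → Sph q → ℝ) (ν : Measure (Sph q)) (N : ℕ) (ξ : Sph q) : ℝ :=
  ν.real {ξ} *
    ∑ k : Fin N, ((gramMat y ν N)⁻¹.mulVec fun i => if (i : ℕ) = 0 then 1 else 0) k * y k ξ

/-- The norm `‖f‖_p` of `L^p(μ_q)`. -/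
def sphNorm {q : ℕ} (p : ENNReal) (f : Sph q → ℝ) : ℝ :=
  (eLpNorm f p (muSph q)).toReal

/-- The discrete norm `(∑_{ξ ∈ C} v_ξ |f(ξ)|^p)^(1/p)`; for `p = ∞` it is `max_{ξ ∈ C} |f(ξ)|`. -/
def discNorm {q : ℕ} (C : Finset (Sph q)) (v : Sph q → ℝ) (p : ENNReal) (f : Sph q → ℝ) : ℝ :=
  if p = ⊤ then ⨆ ξ : C, |f ξ|
  else (∑ ξ ∈ C, v ξ * |f ξ| ^ p.toReal) ^ (1 / p.toReal)

/-- The two-sided Marcinkiewicz–Zygmund inequalities for `Π_n^q` in the `p`-norm. -/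
def TwoSidedMZ {q : ℕ} (n : ℕ) (C : Finset (Sph q)) (v : Sph q → ℝ) (c₁ c₂ : ℝ)
    (p : ENNReal) : Prop :=
  ∀ P ∈ PiSph q n, c₁ * sphNorm p P ≤ discNorm C v p P ∧ discNorm C v p P ≤ c₂ * sphNorm p P

/-- The absolute discrepancy `|∫ P² dν - ∫ P² dμ_q|`. -/
def sqDisc {q : ℕ} (ν : Measure (Sph q)) (P : Sph q → ℝ) : ℝ :=
  |∫ x, P x ^ 2 ∂ν - ∫ x, P x ^ 2 ∂(muSph q)|

/-- `|∫ P² dν - ∫ P² dμ_q| ≤ (κ / n^q) ∫ P² dμ_q` for all `P ∈ Π_n^q`. -/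
def StrongMZ {q : ℕ} (n : ℕ) (κ : ℝ) (ν : Measure (Sph q)) : Prop :=
  ∀ P ∈ PiSph q n, sqDisc ν P ≤ κ / (n : ℝ) ^ q * ∫ x, P x ^ 2 ∂(muSph q)

/-- The measure that associates the mass `1/M` with each of the points `x 1, …, x M`. -/
def empMeasure {q M : ℕ} (x : Fin M → Sph q) : Measure (Sph q) :=
  (M : ENNReal)⁻¹ • ∑ j, Measure.dirac (x j)

end

/-! Parts (a) and (b) use the lower M–Z bound only for `p = 2`. In coordinates with respect to the
`y_k`, the Euclidean norm is that of `L²(μ_q)` and the Gram matrix `G` represents `∫ P² dν`. The M–Z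
inequalities then say `c₁² ≤ G ≤ c₂²`, and (2) says that `G - 1` has norm at most `δ = κ / n^q`.
This requires the first `N` harmonics to lie in `Π_n^q`, which is a dimension count
(`IsHarmonicBasis.deg_le`).

Let `G b = e` with `e` the first unit vector, and `R = ∑ b_k y_k`; the weights are `v_ξ R(ξ)`. Since
`∫ R² dν = b · e ≤ c₁⁻²` and `∑ v_ξ ≤ c₂²`, Cauchy–Schwarz bounds the variation by `c₂ / c₁`. Under
(2), `G (b - e) = -(G - 1) e` gives `|b - e| ≤ δ / c₁²`. The inequality `|f|² ≤ dim Π_n^q · ∫ f²`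
(`sq_le_finrank_mul_integral`) and `dim Π_n^q ≤ 2^(q+1) n^q` turn this into a uniform bound for `R -
1`. Hence `|w_ξ| ≤ c v_ξ`, and the upper M–Z bound for `ν` passes to the weights.

Part (c) is a matrix Chernoff bound for `∑ Y(ξ_j) Y(ξ_j)ᵀ`, where `Y(x)` lists the values at `x` of
an orthonormal basis of `Π_n^q`; by rotation invariance `|Y(x)|² = D = dim Π_n^q`. The trace of the
matrix exponential is replaced by that of `(1 ± t ∑ Y Yᵀ)^m`. For one rank one term `u uᵀ`, the
change of the trace is controlled by a multiple of `u · B^m u` (`trace_pow_add_vecMulVec_le`,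
`trace_pow_sub_vecMulVec_le`), whose mean over the sample is a multiple of `tr B^m`. So each sample
costs one scalar factor. Markov's inequality and `m → ∞` bound each tail by `D exp(-η² M / (8 D))`.
-/

/-! ### Traces of powers under rank one perturbations -/

section RankOne

open Matrix

variable {ι : Type*} [Fintype ι] [DecidableEq ι]

/-- Orthogonal diagonalisation of a real symmetric matrix, in terms of the moments it defines. -/
theorem Matrix.IsHermitian.exists_moments {B : Matrix ι ι ℝ} (hB : B.IsHermitian) :
    ∃ (d : ι → ℝ) (V : Matrix ι ι ℝ), V * Vᵀ = 1 ∧ Vᵀ * V = 1 ∧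
      (∀ k, (B ^ k).trace = ∑ l, d l ^ k) ∧
      ∀ (u : ι → ℝ) (k : ℕ), u ⬝ᵥ B ^ k *ᵥ u = ∑ l, ((Vᵀ *ᵥ u) l) ^ 2 * d l ^ k := by
  obtain ⟨V, d, h1, h2, h3⟩ : ∃ (V : Matrix ι ι ℝ) (d : ι → ℝ), V * Vᵀ = 1 ∧ Vᵀ * V = 1 ∧
      B = V * diagonal d * Vᵀ := by
    refine ⟨hB.eigenvectorUnitary, hB.eigenvalues, ?_, ?_, ?_⟩
    · simpa [star_eq_conjTranspose] using Unitary.coe_mul_star_self hB.eigenvectorUnitary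
    · simpa [star_eq_conjTranspose] using Unitary.coe_star_mul_self hB.eigenvectorUnitary
    · have := hB.spectral_theorem
      simpa [Unitary.conjStarAlgAut_apply, star_eq_conjTranspose, Function.comp_def] using this
  have hpow : ∀ k, B ^ k = V * diagonal (fun l => d l ^ k) * Vᵀ := by
    intro k
    induction k with
    | zero => simp [h1]
    | succ k ih =>
      rw [pow_succ, ih, h3]
      calc V * diagonal (fun l => d l ^ k) * Vᵀ * (V * diagonal d * Vᵀ)
          = V * diagonal (fun l => d l ^ k) * (Vᵀ * V) * diagonal d * Vᵀ := by
            simp only [Matrix.mul_assoc]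
        _ = V * (diagonal (fun l => d l ^ k) * diagonal d) * Vᵀ := by
            rw [h2]; simp only [Matrix.mul_assoc, Matrix.one_mul]
        _ = _ := by rw [diagonal_mul_diagonal]; simp only [pow_succ]
  refine ⟨d, V, h1, h2, fun k => ?_, fun u k => ?_⟩
  · rw [hpow, Matrix.trace_mul_comm, ← Matrix.mul_assoc, h2, Matrix.one_mul, trace_diagonal]
  · rw [hpow, ← mulVec_mulVec, ← mulVec_mulVec, dotProduct_mulVec, ← mulVec_transpose]
    simp only [dotProduct, mulVec_diagonal]
    exact Finset.sum_congr rfl fun l _ => by ring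

/-- The moments of a real symmetric matrix, with diagonal entries that inherit the bounds for
the values of the quadratic form. -/
theorem Matrix.IsHermitian.exists_moments_of_le {B : Matrix ι ι ℝ} (hB : B.IsHermitian) {L : ℝ}
    (hL : ∀ x : ι → ℝ, L * (x ⬝ᵥ x) ≤ x ⬝ᵥ B *ᵥ x) :
    ∃ (d : ι → ℝ), (∀ l, L ≤ d l) ∧
      (∀ U : ℝ, (∀ x : ι → ℝ, x ⬝ᵥ B *ᵥ x ≤ U * (x ⬝ᵥ x)) → ∀ l, d l ≤ U) ∧
      (∀ k, (B ^ k).trace = ∑ l, d l ^ k) ∧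
      ∀ u : ι → ℝ, ∃ w : ι → ℝ, (∀ l, 0 ≤ w l) ∧
        ∀ k : ℕ, u ⬝ᵥ B ^ k *ᵥ u = ∑ l, w l * d l ^ k := by
  obtain ⟨d, V, h1, h2, h3, h4⟩ := hB.exists_moments
  have hv : ∀ l, ∃ x : ι → ℝ, x ⬝ᵥ x = 1 ∧ x ⬝ᵥ B *ᵥ x = d l := by
    intro l
    -- The `l`-th column of `V` is a unit eigenvector; its moments of order 0 and 1 are `1` and `d
    -- l`.
    have hv : Vᵀ *ᵥ (V *ᵥ Pi.single l 1) = Pi.single l 1 := by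
      rw [mulVec_mulVec, h2, one_mulVec]
    have e0 := h4 (V *ᵥ Pi.single l 1) 0
    have e1 := h4 (V *ᵥ Pi.single l 1) 1
    rw [hv] at e0 e1
    simp only [pow_zero, one_mulVec, pow_one, mul_one, Pi.single_apply] at e0 e1
    exact ⟨_, by simpa using e0, by simpa using e1⟩
  refine ⟨d, fun l => ?_, fun U hU l => ?_, h3,
    fun u => ⟨fun l => ((Vᵀ *ᵥ u) l) ^ 2, fun l => sq_nonneg _, h4 u⟩⟩
  · obtain ⟨x, hx, hxd⟩ := hv l
    simpa [hx, hxd] using hL x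
  · obtain ⟨x, hx, hxd⟩ := hv l
    simpa [hx, hxd] using hU x

variable (B : Matrix ι ι ℝ) (u : ι → ℝ)

omit [DecidableEq ι] in
theorem dotProduct_mul_vecMulVec_mul (M N : Matrix ι ι ℝ) :
    u ⬝ᵥ (M * vecMulVec u u * N) *ᵥ u = (u ⬝ᵥ M *ᵥ u) * (u ⬝ᵥ N *ᵥ u) := by
  rw [← mulVec_mulVec, ← mulVec_mulVec, vecMulVec_mulVec, mulVec_smul]
  simp [dotProduct_smul, mul_comm]

theorem dotProduct_pow_mul_pow_succ (j i : ℕ) :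
    u ⬝ᵥ (B ^ j * (B + vecMulVec u u) ^ (i + 1)) *ᵥ u =
      u ⬝ᵥ (B ^ (j + 1) * (B + vecMulVec u u) ^ i) *ᵥ u +
        (u ⬝ᵥ B ^ j *ᵥ u) * (u ⬝ᵥ (B + vecMulVec u u) ^ i *ᵥ u) := by
  rw [← dotProduct_mul_vecMulVec_mul, ← dotProduct_add, ← add_mulVec]
  congr 2
  rw [pow_succ' (B + _), pow_succ]
  noncomm_ring

/-- Telescoping over the words `B ^ (k - i) * (B + u uᵀ) ^ i`: a discrete Duhamel formula, in which
the rank one factor splits every correction into a product of two scalar moments. -/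
theorem dotProduct_pow_eq_sum (k : ℕ) :
    u ⬝ᵥ (B + vecMulVec u u) ^ k *ᵥ u = u ⬝ᵥ B ^ k *ᵥ u +
      ∑ i ∈ Finset.range k, (u ⬝ᵥ B ^ (k - 1 - i) *ᵥ u) *
        (u ⬝ᵥ (B + vecMulVec u u) ^ i *ᵥ u) := by
  have key : ∀ i ≤ k, u ⬝ᵥ (B ^ (k - i) * (B + vecMulVec u u) ^ i) *ᵥ u = u ⬝ᵥ B ^ k *ᵥ u +
      ∑ i ∈ Finset.range i, (u ⬝ᵥ B ^ (k - 1 - i) *ᵥ u) *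
        (u ⬝ᵥ (B + vecMulVec u u) ^ i *ᵥ u) := by
    intro i hi
    induction i with
    | zero => simp
    | succ i ih =>
      rw [dotProduct_pow_mul_pow_succ, Finset.sum_range_succ, ← add_assoc, ← ih (by omega)]
      rw [show k - (i + 1) + 1 = k - i by omega, show k - (i + 1) = k - 1 - i by omega]
  simpa using key k le_rfl

/-- The same telescoping under the trace; cyclicity turns each increment into a quadratic form in
`u`. -/
theorem trace_pow_sub_trace_pow (m : ℕ) :
    ((B + vecMulVec u u) ^ m).trace = (B ^ m).trace +
      ∑ i ∈ Finset.range m, u ⬝ᵥ (B ^ (m - 1 - i) * (B + vecMulVec u u) ^ i) *ᵥ u := by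
  have key : ∀ i ≤ m, ((B + vecMulVec u u) ^ i * B ^ (m - i)).trace = (B ^ m).trace +
      ∑ i ∈ Finset.range i, u ⬝ᵥ (B ^ (m - 1 - i) * (B + vecMulVec u u) ^ i) *ᵥ u := by
    intro i hi
    induction i with
    | zero => simp
    | succ i ih =>
      rw [Finset.sum_range_succ, ← add_assoc, ← ih (by omega), show m - i = m - 1 - i + 1 by omega,
        show m - (i + 1) = m - 1 - i by omega]
      have : u ⬝ᵥ (B ^ (m - 1 - i) * (B + vecMulVec u u) ^ i) *ᵥ u =
          ((B + vecMulVec u u) ^ i * vecMulVec u u * B ^ (m - 1 - i)).trace := by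
        rw [Matrix.trace_mul_comm, ← Matrix.mul_assoc, mul_vecMulVec, trace_vecMulVec,
          dotProduct_comm]
      rw [this, ← Matrix.trace_add]
      congr 1
      rw [pow_succ (B + _), pow_succ']
      noncomm_ring
  simpa using key m le_rfl

variable {B u}

/-- Log-convexity of the moments of a symmetric positive definite matrix. -/
theorem moments_of_le (hB : B.IsHermitian) {L : ℝ} (hL0 : 0 < L)
    (hL : ∀ x : ι → ℝ, L * (x ⬝ᵥ x) ≤ x ⬝ᵥ B *ᵥ x) :
    (∀ k, 0 ≤ u ⬝ᵥ B ^ k *ᵥ u) ∧ (∀ k, L * (u ⬝ᵥ B ^ k *ᵥ u) ≤ u ⬝ᵥ B ^ (k + 1) *ᵥ u) ∧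
      ∀ i j, (u ⬝ᵥ B ^ i *ᵥ u) * (u ⬝ᵥ B ^ j *ᵥ u) ≤ (u ⬝ᵥ u) * (u ⬝ᵥ B ^ (i + j) *ᵥ u) := by
  obtain ⟨d, hd, -, -, hw⟩ := hB.exists_moments_of_le hL
  obtain ⟨w, hw0, hw⟩ := hw u
  have hd0 : ∀ l, 0 ≤ d l := fun l => hL0.le.trans (hd l)
  refine ⟨fun k => ?_, fun k => ?_, fun i j => ?_⟩
  · rw [hw]
    exact Finset.sum_nonneg fun l _ => mul_nonneg (hw0 l) (pow_nonneg (hd0 l) _)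
  · rw [hw, hw, Finset.mul_sum]
    refine Finset.sum_le_sum fun l _ => ?_
    have := mul_le_mul_of_nonneg_left (hd l) (mul_nonneg (hw0 l) (pow_nonneg (hd0 l) k))
    rw [pow_succ]; linarith
  · have h0 := hw 0
    simp only [pow_zero, one_mulVec, mul_one] at h0
    rw [hw, hw, hw, h0]
    -- Chebyshev's sum inequality by symmetrisation: both powers are monotone on nonnegative
    -- numbers, so the two differences have the same sign.
    have hpos : 0 ≤ ∑ k, ∑ l, w k * w l * ((d k ^ i - d l ^ i) * (d k ^ j - d l ^ j)) := by
      refine Finset.sum_nonneg fun k _ => Finset.sum_nonneg fun l _ =>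
        mul_nonneg (mul_nonneg (hw0 k) (hw0 l)) ?_
      rcases le_total (d k) (d l) with h | h
      · exact mul_nonneg_of_nonpos_of_nonpos
          (sub_nonpos.2 (pow_le_pow_left₀ (hd0 k) h _)) (sub_nonpos.2 (pow_le_pow_left₀ (hd0 k) h _))
      · exact mul_nonneg
          (sub_nonneg.2 (pow_le_pow_left₀ (hd0 l) h _)) (sub_nonneg.2 (pow_le_pow_left₀ (hd0 l) h _))
    have hexp : ∑ k, ∑ l, w k * w l * ((d k ^ i - d l ^ i) * (d k ^ j - d l ^ j)) =
        2 * ((∑ l, w l) * ∑ l, w l * d l ^ (i + j)) -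
          2 * ((∑ l, w l * d l ^ i) * ∑ l, w l * d l ^ j) := by
      have e : ∀ k l, w k * w l * ((d k ^ i - d l ^ i) * (d k ^ j - d l ^ j)) =
          (w k * d k ^ (i + j)) * w l + w k * (w l * d l ^ (i + j))
            - (w k * d k ^ i) * (w l * d l ^ j) - (w k * d k ^ j) * (w l * d l ^ i) := by
        intro k l; rw [pow_add, pow_add]; ring
      simp only [e, Finset.sum_sub_distrib, Finset.sum_add_distrib, ← Finset.sum_mul_sum]
      ring
    linarith

omit [Fintype ι] [DecidableEq ι] in
theorem isHermitian_add_vecMulVec (hB : B.IsHermitian) : (B + vecMulVec u u).IsHermitian := by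
  refine hB.add ?_
  ext i j
  simp [vecMulVec_apply, mul_comm]

omit [DecidableEq ι] in
theorem dotProduct_add_vecMulVec (x : ι → ℝ) :
    x ⬝ᵥ (B + vecMulVec u u) *ᵥ x = x ⬝ᵥ B *ᵥ x + (u ⬝ᵥ x) ^ 2 := by
  rw [add_mulVec, dotProduct_add, vecMulVec_mulVec]
  simp [dotProduct_smul, sq, dotProduct_comm x u]

omit [DecidableEq ι] in
theorem le_dotProduct_add_vecMulVec {L : ℝ} (hL : ∀ x : ι → ℝ, L * (x ⬝ᵥ x) ≤ x ⬝ᵥ B *ᵥ x)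
    (x : ι → ℝ) : L * (x ⬝ᵥ x) ≤ x ⬝ᵥ (B + vecMulVec u u) *ᵥ x := by
  rw [dotProduct_add_vecMulVec]
  linarith [hL x, sq_nonneg (u ⬝ᵥ x)]

/-- In the Duhamel formula, the product of the moments of `B` of orders `k - 1 - i` and `i` is at
most `ρ` times that of order `k - 1`, hence at most `ρ / L` times that of order `k`. By strong
induction the corrections form a geometric series with ratio `1 + ρ / L`. -/
theorem dotProduct_pow_add_vecMulVec_le (hB : B.IsHermitian) {L ρ : ℝ} (hL0 : 0 < L)
    (hL : ∀ x : ι → ℝ, L * (x ⬝ᵥ x) ≤ x ⬝ᵥ B *ᵥ x) (hρ : u ⬝ᵥ u ≤ ρ) (k : ℕ) :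
    u ⬝ᵥ (B + vecMulVec u u) ^ k *ᵥ u ≤ (1 + ρ / L) ^ k * (u ⬝ᵥ B ^ k *ᵥ u) := by
  obtain ⟨ha0, haL, haa⟩ := moments_of_le (u := u) hB hL0 hL
  have hρ0 : 0 ≤ ρ := le_trans (by simpa using ha0 0) hρ
  have hx : 0 ≤ ρ / L := div_nonneg hρ0 hL0.le
  induction k using Nat.strong_induction_on with
  | _ k ih =>
  rw [dotProduct_pow_eq_sum]
  have hterm : ∀ i ∈ Finset.range k, (u ⬝ᵥ B ^ (k - 1 - i) *ᵥ u) *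
      (u ⬝ᵥ (B + vecMulVec u u) ^ i *ᵥ u) ≤
        (1 + ρ / L) ^ i * (ρ / L) * (u ⬝ᵥ B ^ k *ᵥ u) := by
    intro i hi
    have hi := Finset.mem_range.1 hi
    have h1 := mul_le_mul_of_nonneg_left (ih i hi) (ha0 (k - 1 - i))
    have h2 := haa (k - 1 - i) i
    rw [show k - 1 - i + i = k - 1 by omega] at h2
    have h3 := haL (k - 1)
    rw [show k - 1 + 1 = k by omega] at h3
    have h4 : (u ⬝ᵥ u) * (u ⬝ᵥ B ^ (k - 1) *ᵥ u) ≤ ρ / L * (u ⬝ᵥ B ^ k *ᵥ u) := by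
      calc (u ⬝ᵥ u) * (u ⬝ᵥ B ^ (k - 1) *ᵥ u) ≤ ρ * (u ⬝ᵥ B ^ (k - 1) *ᵥ u) :=
            mul_le_mul_of_nonneg_right hρ (ha0 _)
        _ = ρ / L * (L * (u ⬝ᵥ B ^ (k - 1) *ᵥ u)) := by field_simp
        _ ≤ _ := mul_le_mul_of_nonneg_left h3 hx
    have h5 := mul_le_mul_of_nonneg_left (h2.trans h4) (pow_nonneg (add_nonneg zero_le_one hx) i)
    linarith
  have hgeom : ∀ k : ℕ, 1 + ∑ i ∈ Finset.range k, (1 + ρ / L) ^ i * (ρ / L) = (1 + ρ / L) ^ k := by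
    intro k
    induction k with
    | zero => simp
    | succ k ihk => rw [Finset.sum_range_succ, ← add_assoc, ihk, pow_succ]; ring
  calc _ ≤ u ⬝ᵥ B ^ k *ᵥ u + ∑ i ∈ Finset.range k,
        (1 + ρ / L) ^ i * (ρ / L) * (u ⬝ᵥ B ^ k *ᵥ u) := by
        have := Finset.sum_le_sum hterm; linarith
    _ = _ := by rw [← Finset.sum_mul, ← hgeom k]; ring

/-- Replacing one factor `B` by `B + u uᵀ` adds a product of two nonnegative moments. -/
theorem dotProduct_mixed_bounds (hB : B.IsHermitian) {L : ℝ} (hL0 : 0 < L)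
    (hL : ∀ x : ι → ℝ, L * (x ⬝ᵥ x) ≤ x ⬝ᵥ B *ᵥ x) (j i : ℕ) :
    u ⬝ᵥ B ^ (j + i) *ᵥ u ≤ u ⬝ᵥ (B ^ j * (B + vecMulVec u u) ^ i) *ᵥ u ∧
      u ⬝ᵥ (B ^ j * (B + vecMulVec u u) ^ i) *ᵥ u ≤ u ⬝ᵥ (B + vecMulVec u u) ^ (j + i) *ᵥ u := by
  have ha := (moments_of_le (u := u) hB hL0 hL).1
  have hb := (moments_of_le (u := u) (isHermitian_add_vecMulVec (u := u) hB) hL0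
    (le_dotProduct_add_vecMulVec hL)).1
  constructor
  · induction i generalizing j with
    | zero => simp
    | succ i ih =>
      rw [dotProduct_pow_mul_pow_succ, show j + (i + 1) = j + 1 + i by ring]
      linarith [ih (j + 1), mul_nonneg (ha j) (hb i)]
  · induction j generalizing i with
    | zero => simp
    | succ j ih =>
      have := ih (i + 1)
      rw [dotProduct_pow_mul_pow_succ] at this
      rw [show j + 1 + i = j + (i + 1) by ring]
      linarith [mul_nonneg (ha j) (hb i)]

theorem trace_pow_bounds (hB : B.IsHermitian) {L : ℝ} (hL0 : 0 < L)
    (hL : ∀ x : ι → ℝ, L * (x ⬝ᵥ x) ≤ x ⬝ᵥ B *ᵥ x) (m : ℕ) :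
    (B ^ m).trace + m * (u ⬝ᵥ B ^ (m - 1) *ᵥ u) ≤ ((B + vecMulVec u u) ^ m).trace ∧
      ((B + vecMulVec u u) ^ m).trace ≤
        (B ^ m).trace + m * (u ⬝ᵥ (B + vecMulVec u u) ^ (m - 1) *ᵥ u) := by
  rw [trace_pow_sub_trace_pow]
  have key := fun i (hi : i ∈ Finset.range m) => by
    simpa [show m - 1 - i + i = m - 1 by have := Finset.mem_range.1 hi; omega] using
      dotProduct_mixed_bounds (u := u) hB hL0 hL (m - 1 - i) i
  constructor
  · gcongr
    simpa using Finset.sum_le_sum fun i hi => (key i hi).1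
  · gcongr
    simpa using Finset.sum_le_sum fun i hi => (key i hi).2

/-- Adding a rank one matrix to a symmetric matrix `B ≥ 1`. -/
theorem trace_pow_add_vecMulVec_le (hB : B.IsHermitian) {ρ : ℝ}
    (hL : ∀ x : ι → ℝ, x ⬝ᵥ x ≤ x ⬝ᵥ B *ᵥ x) (hρ : u ⬝ᵥ u ≤ ρ) (m : ℕ) :
    ((B + vecMulVec u u) ^ m).trace ≤
      (B ^ m).trace + m * (1 + ρ) ^ m * (u ⬝ᵥ B ^ m *ᵥ u) := by
  have hL' : ∀ x : ι → ℝ, 1 * (x ⬝ᵥ x) ≤ x ⬝ᵥ B *ᵥ x := by simpa using hL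
  obtain ⟨ha0, haL, -⟩ := moments_of_le (u := u) hB one_pos hL'
  have hρ0 : 0 ≤ ρ := le_trans (by simpa using ha0 0) hρ
  rcases m with _ | m
  · simp
  refine (trace_pow_bounds hB one_pos hL' _).2.trans ?_
  rw [mul_assoc]
  gcongr
  -- Because `B ≥ 1`, the exponent may be raised by one; the correction then contains the same power
  -- of `B` as the trace, as the induction over samples requires.
  calc _ ≤ (1 + ρ) ^ m * (u ⬝ᵥ B ^ m *ᵥ u) := by
        simpa using dotProduct_pow_add_vecMulVec_le hB one_pos hL' hρ m
    _ ≤ (1 + ρ) ^ (m + 1) * (u ⬝ᵥ B ^ (m + 1) *ᵥ u) := by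
        gcongr ?_ * ?_
        · exact ha0 m
        · exact pow_le_pow_right₀ (by linarith) (by omega)
        · simpa using haL m

/-- Subtracting a rank one matrix from a symmetric matrix `B ≤ 1`. -/
theorem trace_pow_sub_vecMulVec_le (hB : B.IsHermitian) {L ρ : ℝ} (hL0 : 0 < L)
    (hL : ∀ x : ι → ℝ, L * (x ⬝ᵥ x) ≤ x ⬝ᵥ (B - vecMulVec u u) *ᵥ x)
    (hB1 : ∀ x : ι → ℝ, x ⬝ᵥ B *ᵥ x ≤ x ⬝ᵥ x) (hρ : u ⬝ᵥ u ≤ ρ) (m : ℕ) :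
    ((B - vecMulVec u u) ^ m).trace ≤
      (B ^ m).trace - m * ((1 + ρ / L) ^ m)⁻¹ * (u ⬝ᵥ B ^ m *ᵥ u) := by
  set A := B - vecMulVec u u with hA
  have hBA : B = A + vecMulVec u u := by simp [hA]
  have hAH : A.IsHermitian := by
    refine hB.sub ?_
    ext i j
    simp [vecMulVec_apply, mul_comm]
  rcases m with _ | m
  · simp
  have hu0 : 0 ≤ u ⬝ᵥ u := by simpa using (moments_of_le (u := u) hAH hL0 hL).1 0
  have hρ0 : 0 ≤ ρ / L := div_nonneg (hu0.trans hρ) hL0.le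
  have h1 := (trace_pow_bounds (u := u) hAH hL0 hL (m + 1)).1
  have h2 := dotProduct_pow_add_vecMulVec_le hAH hL0 hL hρ m
  rw [← hBA] at h1 h2
  simp only [Nat.add_sub_cancel] at h1
  have hBL : ∀ x : ι → ℝ, L * (x ⬝ᵥ x) ≤ x ⬝ᵥ B *ᵥ x := fun x => by
    rw [hBA]; exact le_dotProduct_add_vecMulVec hL x
  -- Here `B ≤ 1` is what allows the exponent to be raised, since the correction is subtracted.
  have h3 : u ⬝ᵥ B ^ (m + 1) *ᵥ u ≤ u ⬝ᵥ B ^ m *ᵥ u := by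
    obtain ⟨d, hdL, hdU, -, hw⟩ := hB.exists_moments_of_le hBL
    obtain ⟨w, hw0, hw⟩ := hw u
    have hd1 := hdU 1 (by simpa using hB1)
    rw [hw, hw]
    refine Finset.sum_le_sum fun l _ => mul_le_mul_of_nonneg_left ?_ (hw0 l)
    exact pow_le_pow_of_le_one (hL0.le.trans (hdL l)) (hd1 l) (by omega)
  have hpow : 0 < (1 + ρ / L) ^ (m + 1) := by positivity
  have h4 : ((1 + ρ / L) ^ (m + 1))⁻¹ * (u ⬝ᵥ B ^ (m + 1) *ᵥ u) ≤ u ⬝ᵥ A ^ m *ᵥ u := by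
    rw [inv_mul_le_iff₀ hpow]
    refine h3.trans (h2.trans ?_)
    gcongr ?_ * _
    · exact (moments_of_le (u := u) hAH hL0 hL).1 m
    · exact pow_le_pow_right₀ (by linarith) (by omega)
  have h5 := mul_le_mul_of_nonneg_left h4 (Nat.cast_nonneg (α := ℝ) (m + 1))
  linarith

/-- If the quadratic form of a positive semidefinite matrix reaches `t` on a unit vector, then
the trace of the `m`-th power is at least `t ^ m`. -/
theorem le_trace_pow (hB : B.IsHermitian) (hB0 : ∀ x : ι → ℝ, 0 ≤ x ⬝ᵥ B *ᵥ x) {t : ℝ}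
    (ht : 0 ≤ t) {x : ι → ℝ} (hx : x ≠ 0) (h : t * (x ⬝ᵥ x) ≤ x ⬝ᵥ B *ᵥ x) (m : ℕ) :
    t ^ m ≤ (B ^ m).trace := by
  obtain ⟨d, hd0, -, htr, hw⟩ := hB.exists_moments_of_le (L := 0) (by simpa using hB0)
  obtain ⟨w, hw0, hw⟩ := hw x
  have h0 := hw 0
  have h1 := hw 1
  simp only [pow_zero, one_mulVec, mul_one, pow_one] at h0 h1
  have hxx : 0 < x ⬝ᵥ x := by
    refine lt_of_le_of_ne (Finset.sum_nonneg fun i _ => mul_self_nonneg _) fun h => hx ?_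
    exact dotProduct_self_eq_zero.1 h.symm
  -- The Rayleigh quotient is a weighted mean of the `d l`, so they cannot all lie below `t` where
  -- the weight is positive.
  obtain ⟨l, hl⟩ : ∃ l, t ≤ d l := by
    by_contra! hcon
    rw [h0, h1, Finset.mul_sum] at h
    rw [h0] at hxx
    obtain ⟨l, -, hl⟩ := Finset.exists_ne_zero_of_sum_ne_zero hxx.ne'
    refine absurd h (not_le.2 (Finset.sum_lt_sum (fun l _ => ?_) ⟨l, Finset.mem_univ _, ?_⟩))
    · nlinarith [hw0 l, hcon l]
    · nlinarith [lt_of_le_of_ne (hw0 l) (Ne.symm hl), hcon l]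
  rw [htr]
  calc t ^ m ≤ d l ^ m := pow_le_pow_left₀ ht hl m
    _ ≤ _ := Finset.single_le_sum (f := fun l => d l ^ m)
        (fun l _ => pow_nonneg (hd0 l) m) (Finset.mem_univ l)

end RankOne

/-! ### A matrix Chernoff bound for sums of random rank one matrices -/

section RandomSum

open Matrix

variable {Ω ι : Type*} [Fintype ι] [DecidableEq ι]

/-- The sum of the rank one matrices defined by the values of `Y` at given points. -/
def sumOuter {k : ℕ} (Y : Ω → ι → ℝ) (x : Fin k → Ω) : Matrix ι ι ℝ :=
  ∑ j, vecMulVec (Y (x j)) (Y (x j))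

omit [Fintype ι] [DecidableEq ι] in
theorem isHermitian_sumOuter {k : ℕ} (Y : Ω → ι → ℝ) (x : Fin k → Ω) :
    (sumOuter Y x).IsHermitian := by
  ext i j
  simp [sumOuter, Matrix.sum_apply, vecMulVec_apply, mul_comm]

omit [DecidableEq ι] in
theorem dotProduct_sumOuter {k : ℕ} (Y : Ω → ι → ℝ) (x : Fin k → Ω) (a : ι → ℝ) :
    a ⬝ᵥ sumOuter Y x *ᵥ a = ∑ j, (Y (x j) ⬝ᵥ a) ^ 2 := by
  rw [sumOuter, Matrix.sum_mulVec, dotProduct_sum]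
  refine Finset.sum_congr rfl fun j _ => ?_
  rw [vecMulVec_mulVec]
  simp [dotProduct_smul, sq, dotProduct_comm]

omit [DecidableEq ι] in
theorem sq_dotProduct_le (u a : ι → ℝ) : (u ⬝ᵥ a) ^ 2 ≤ (u ⬝ᵥ u) * (a ⬝ᵥ a) := by
  simpa [dotProduct, sq] using Finset.sum_mul_sq_le_sq_mul_sq Finset.univ u a

omit [DecidableEq ι] in
theorem dotProduct_sumOuter_le {k : ℕ} {Y : Ω → ι → ℝ} {ρ : ℝ} (hρ : ∀ x, Y x ⬝ᵥ Y x ≤ ρ)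
    (x : Fin k → Ω) (a : ι → ℝ) : a ⬝ᵥ sumOuter Y x *ᵥ a ≤ k * ρ * (a ⬝ᵥ a) := by
  have ha : 0 ≤ a ⬝ᵥ a := Finset.sum_nonneg fun i _ => mul_self_nonneg _
  rw [dotProduct_sumOuter]
  calc _ ≤ ∑ _j : Fin k, ρ * (a ⬝ᵥ a) := Finset.sum_le_sum fun j _ =>
        (sq_dotProduct_le _ _).trans (mul_le_mul_of_nonneg_right (hρ _) ha)
    _ = _ := by simp [mul_assoc]

omit [DecidableEq ι] in
theorem dotProduct_sumOuter_nonneg {k : ℕ} (Y : Ω → ι → ℝ) (x : Fin k → Ω) (a : ι → ℝ) :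
    0 ≤ a ⬝ᵥ sumOuter Y x *ᵥ a := by
  rw [dotProduct_sumOuter]
  exact Finset.sum_nonneg fun j _ => sq_nonneg _

omit [Fintype ι] [DecidableEq ι] in
theorem sumOuter_cons {k : ℕ} (Y : Ω → ι → ℝ) (x : Fin (k + 1) → Ω) :
    sumOuter Y x = sumOuter Y (fun j => x (Fin.succ j)) + vecMulVec (Y (x 0)) (Y (x 0)) := by
  rw [sumOuter, Fin.sum_univ_succ, add_comm]; rfl

variable [TopologicalSpace Ω] [CompactSpace Ω] [SecondCountableTopology Ω]
  [MeasurableSpace Ω] [BorelSpace Ω] (μ : Measure Ω) [IsProbabilityMeasure μ]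
  {Y : Ω → ι → ℝ}

omit [Fintype ι] [DecidableEq ι] [CompactSpace Ω] [SecondCountableTopology Ω]
  [MeasurableSpace Ω] [BorelSpace Ω] in
theorem continuous_sumOuter (hY : Continuous Y) (k : ℕ) :
    Continuous fun x : Fin k → Ω => sumOuter Y x := by
  unfold sumOuter
  exact continuous_finsetSum _ fun j _ => by fun_prop

theorem Continuous.integrable_of_compactSpace {X : Type*} [TopologicalSpace X] [CompactSpace X]
    [MeasurableSpace X] [OpensMeasurableSpace X] {ν : Measure X} [IsFiniteMeasure ν]
    {f : X → ℝ} (hf : Continuous f) : Integrable f ν :=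
  hf.integrable_of_hasCompactSupport (HasCompactSupport.of_compactSpace f)

-- Isotropy of `Y` makes the mean of the rank one correction a multiple of the trace itself, which
-- closes the recursion over the samples.
omit [SecondCountableTopology Ω] in
theorem integral_quadForm (hY : Continuous Y) {σ : ℝ}
    (hσ : ∀ i j, ∫ x, Y x i * Y x j ∂μ = if i = j then σ else 0) (A : Matrix ι ι ℝ) :
    ∫ x, Y x ⬝ᵥ A *ᵥ Y x ∂μ = σ * A.trace := by
  have hint : ∀ i j, Integrable (fun x => Y x i * (A i j * Y x j)) μ := fun i j =>
    Continuous.integrable_of_compactSpace (by fun_prop)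
  simp only [dotProduct, mulVec, Finset.mul_sum]
  rw [integral_finsetSum _ fun i _ => integrable_finsetSum _ fun j _ => hint i j]
  simp_rw [integral_finsetSum _ fun j _ => hint _ j, mul_left_comm _ (A _ _), integral_const_mul,
    hσ]
  simp [Matrix.trace, Finset.mul_sum, mul_comm]

theorem integral_pi_succ {k : ℕ} {f : (Fin (k + 1) → Ω) → ℝ} (hf : Continuous f) :
    Integrable (fun y => ∫ x, f (Fin.cons x y) ∂μ) (Measure.pi fun _ : Fin k => μ) ∧
    ∫ x, f x ∂(Measure.pi fun _ => μ) =
      ∫ y, ∫ x, f (Fin.cons x y) ∂μ ∂(Measure.pi fun _ : Fin k => μ) := by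
  have e := (measurePreserving_piFinSuccAbove (fun _ : Fin (k + 1) => μ) 0).symm
  have hc : Continuous fun p : Ω × (Fin k → Ω) => (Fin.cons p.1 p.2 : Fin (k + 1) → Ω) := by
    fun_prop
  have hint : Integrable (fun p : Ω × (Fin k → Ω) => f (Fin.cons p.1 p.2))
      (μ.prod (Measure.pi fun _ : Fin k => μ)) :=
    Continuous.integrable_of_compactSpace (hf.comp hc)
  refine ⟨hint.integral_prod_right, ?_⟩
  rw [← e.integral_comp' (g := f)]
  simpa [MeasurableEquiv.piFinSuccAbove, Fin.insertNthEquiv] using integral_prod_symm _ hint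

variable {σ ρ : ℝ}

/-- Conditioning on all samples but the first, the rank one estimate and isotropy yield one factor
`1 + m (1 + ρ)^m σ` per sample; `Fintype.card ι` is the trace of the identity. -/
theorem integral_trace_one_add_le (hY : Continuous Y)
    (hσ : ∀ i j, ∫ x, Y x i * Y x j ∂μ = if i = j then σ else 0) (hσ0 : 0 ≤ σ) (hρ0 : 0 ≤ ρ)
    (hρ : ∀ x, Y x ⬝ᵥ Y x ≤ ρ) (m k : ℕ) :
    ∫ x, ((1 + sumOuter Y x) ^ m).trace ∂(Measure.pi fun _ : Fin k => μ) ≤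
      Fintype.card ι * (1 + m * (1 + ρ) ^ m * σ) ^ k := by
  have hcont : ∀ k, Continuous fun x : Fin k → Ω => ((1 + sumOuter Y x) ^ m).trace := fun k =>
    ((continuous_const.add (continuous_sumOuter hY k)).pow m).matrix_trace
  induction k with
  | zero => simp [sumOuter]
  | succ k ih =>
    obtain ⟨hint, heq⟩ := integral_pi_succ μ (hcont (k + 1))
    rw [heq]
    have hstep : ∀ y : Fin k → Ω, ∫ x, ((1 + sumOuter Y (Fin.cons x y : Fin (k + 1) → Ω)) ^ m).trace ∂μ ≤
        (1 + m * (1 + ρ) ^ m * σ) * ((1 + sumOuter Y y) ^ m).trace := by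
      intro y
      set B := 1 + sumOuter Y y with hB
      have hBH : B.IsHermitian := isHermitian_one.add (isHermitian_sumOuter Y y)
      have hBL : ∀ a : ι → ℝ, a ⬝ᵥ a ≤ a ⬝ᵥ B *ᵥ a := fun a => by
        rw [hB, add_mulVec, dotProduct_add, one_mulVec]
        linarith [dotProduct_sumOuter_nonneg Y y a]
      calc _ ≤ ∫ x, ((B ^ m).trace + m * (1 + ρ) ^ m * (Y x ⬝ᵥ B ^ m *ᵥ Y x)) ∂μ := by
            refine integral_mono (Continuous.integrable_of_compactSpace ?_)
              (Continuous.integrable_of_compactSpace (by fun_prop)) fun x => ?_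
            · exact (hcont (k + 1)).comp (by fun_prop)
            · have := trace_pow_add_vecMulVec_le hBH hBL (hρ x) m
              simpa [sumOuter_cons, hB, add_assoc] using this
        _ = _ := by
            rw [integral_add (by simp) (Continuous.integrable_of_compactSpace (by fun_prop)),
              integral_const_mul, integral_quadForm μ hY hσ]
            simp; ring
    calc _ ≤ ∫ y, (1 + m * (1 + ρ) ^ m * σ) * ((1 + sumOuter Y y) ^ m).trace
              ∂(Measure.pi fun _ : Fin k => μ) := by
          exact integral_mono hint
            (Continuous.integrable_of_compactSpace (continuous_const.mul (hcont k))) hstep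
      _ ≤ _ := by
          rw [integral_const_mul, pow_succ]
          have : 0 ≤ 1 + m * (1 + ρ) ^ m * σ := by positivity
          nlinarith [mul_le_mul_of_nonneg_left ih this]

/-- The condition `hk` keeps every partial difference at least `1 / 2`, so the rank one estimate
applies with `L = 1 / 2`, whence `2 * ρ`; `hm` makes the factor per sample nonnegative. -/
theorem integral_trace_one_sub_le (hY : Continuous Y)
    (hσ : ∀ i j, ∫ x, Y x i * Y x j ∂μ = if i = j then σ else 0) (hρ0 : 0 ≤ ρ)
    (hρ : ∀ x, Y x ⬝ᵥ Y x ≤ ρ) (m k : ℕ) (hk : k * ρ ≤ 1 / 2)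
    (hm : m * ((1 + 2 * ρ) ^ m)⁻¹ * σ ≤ 1) :
    ∫ x, ((1 - sumOuter Y x) ^ m).trace ∂(Measure.pi fun _ : Fin k => μ) ≤
      Fintype.card ι * (1 - m * ((1 + 2 * ρ) ^ m)⁻¹ * σ) ^ k := by
  have hcont : ∀ k, Continuous fun x : Fin k → Ω => ((1 - sumOuter Y x) ^ m).trace := fun k =>
    ((continuous_const.sub (continuous_sumOuter hY k)).pow m).matrix_trace
  induction k with
  | zero => simp [sumOuter]
  | succ k ih =>
    have hk' : k * ρ ≤ 1 / 2 := by push_cast at hk; linarith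
    obtain ⟨hint, heq⟩ := integral_pi_succ μ (hcont (k + 1))
    rw [heq]
    have hstep : ∀ y : Fin k → Ω,
        ∫ x, ((1 - sumOuter Y (Fin.cons x y : Fin (k + 1) → Ω)) ^ m).trace ∂μ ≤
        (1 - m * ((1 + 2 * ρ) ^ m)⁻¹ * σ) * ((1 - sumOuter Y y) ^ m).trace := by
      intro y
      set B := 1 - sumOuter Y y with hB
      have hBH : B.IsHermitian := isHermitian_one.sub (isHermitian_sumOuter Y y)
      have hsub : ∀ x, B - vecMulVec (Y x) (Y x) =
          1 - sumOuter Y (Fin.cons x y : Fin (k + 1) → Ω) := fun x => by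
        simp [sumOuter_cons, hB, sub_sub]
      have hBL : ∀ x, ∀ a : ι → ℝ, 1 / 2 * (a ⬝ᵥ a) ≤
          a ⬝ᵥ (B - vecMulVec (Y x) (Y x)) *ᵥ a := fun x a => by
        rw [hsub, sub_mulVec, dotProduct_sub, one_mulVec]
        have h1 := dotProduct_sumOuter_le hρ (Fin.cons x y : Fin (k + 1) → Ω) a
        have ha : 0 ≤ a ⬝ᵥ a := Finset.sum_nonneg fun i _ => mul_self_nonneg _
        nlinarith [mul_le_mul_of_nonneg_right hk ha]
      have hBU : ∀ a : ι → ℝ, a ⬝ᵥ B *ᵥ a ≤ a ⬝ᵥ a := fun a => by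
        rw [hB, sub_mulVec, dotProduct_sub, one_mulVec]
        linarith [dotProduct_sumOuter_nonneg Y y a]
      calc _ ≤ ∫ x, ((B ^ m).trace - m * ((1 + 2 * ρ) ^ m)⁻¹ * (Y x ⬝ᵥ B ^ m *ᵥ Y x)) ∂μ := by
            refine integral_mono (Continuous.integrable_of_compactSpace ?_)
              (Continuous.integrable_of_compactSpace (by fun_prop)) fun x => ?_
            · exact (hcont (k + 1)).comp (by fun_prop)
            · have := trace_pow_sub_vecMulVec_le hBH (by norm_num) (hBL x) hBU (hρ x) m
              rw [hsub, show ρ / (1 / 2) = 2 * ρ by ring] at this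
              exact this
        _ = _ := by
            rw [integral_sub (by simp) (Continuous.integrable_of_compactSpace (by fun_prop)),
              integral_const_mul, integral_quadForm μ hY hσ]
            simp; ring
    calc _ ≤ ∫ y, (1 - m * ((1 + 2 * ρ) ^ m)⁻¹ * σ) * ((1 - sumOuter Y y) ^ m).trace
              ∂(Measure.pi fun _ : Fin k => μ) := by
          exact integral_mono hint
            (Continuous.integrable_of_compactSpace (continuous_const.mul (hcont k))) hstep
      _ ≤ _ := by
          rw [integral_const_mul, pow_succ]
          nlinarith [mul_le_mul_of_nonneg_left (ih hk') (sub_nonneg.2 hm)]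

omit [DecidableEq ι] [TopologicalSpace Ω] [CompactSpace Ω] [SecondCountableTopology Ω]
  [MeasurableSpace Ω] [BorelSpace Ω] in
theorem dotProduct_sumOuter_smul {k : ℕ} {t : ℝ} (ht : 0 ≤ t) (x : Fin k → Ω) (a : ι → ℝ) :
    a ⬝ᵥ sumOuter (fun x => √t • Y x) x *ᵥ a = t * ∑ j, (Y (x j) ⬝ᵥ a) ^ 2 := by
  rw [dotProduct_sumOuter, Finset.mul_sum]
  refine Finset.sum_congr rfl fun j _ => ?_
  rw [smul_dotProduct, smul_eq_mul, mul_pow, Real.sq_sqrt ht]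

variable {D : ℝ}

-- Markov's inequality for `tr (1 + (θ / (m M)) ∑ Y Yᵀ)^m`, followed by `m → ∞`, where `(1 + s /
-- m)^m` becomes `exp s`. Only scalar exponentials occur.
open Filter Topology in
theorem measure_upper_deviation_le (hY : Continuous Y)
    (hδ : ∀ i j, ∫ x, Y x i * Y x j ∂μ = if i = j then 1 else 0) (hD : 0 < D)
    (hYD : ∀ x, Y x ⬝ᵥ Y x ≤ D) {M : ℕ} (hM : 0 < M) {η : ℝ} (hη : 0 < η) (hη1 : η ≤ 1) :
    (Measure.pi fun _ : Fin M => μ).real {x | ∃ a : ι → ℝ, a ≠ 0 ∧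
      (1 + η) * (a ⬝ᵥ a) ≤ (M : ℝ)⁻¹ * ∑ j, (Y (x j) ⬝ᵥ a) ^ 2} ≤
      Fintype.card ι * Real.exp (-(η ^ 2 * M / (8 * D))) := by
  set S := {x : Fin M → Ω | ∃ a : ι → ℝ, a ≠ 0 ∧
      (1 + η) * (a ⬝ᵥ a) ≤ (M : ℝ)⁻¹ * ∑ j, (Y (x j) ⬝ᵥ a) ^ 2}
  have hM' : (0 : ℝ) < M := Nat.cast_pos.2 hM
  -- This choice gives `θ D / M = η / 4`; as `exp (η / 4) ≤ 1 + η / 2`, the final exponent is at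
  -- most `-θ η / 2`.
  set θ : ℝ := η * M / (4 * D) with hθ
  have hθ0 : 0 < θ := by positivity
  have key : ∀ m : ℕ, 0 < m → (1 + θ * (1 + η) / m) ^ m * (Measure.pi fun _ : Fin M => μ).real S ≤
      Fintype.card ι * Real.exp (θ * Real.exp (θ * D / M)) := by
    intro m hm
    have hm' : (0 : ℝ) < m := Nat.cast_pos.2 hm
    set t : ℝ := θ / (m * M) with ht
    have ht0 : 0 ≤ t := by positivity
    set Z : Ω → ι → ℝ := fun x => √t • Y x with hZ
    have hZc : Continuous Z := by fun_prop
    have hZδ : ∀ i j, ∫ x, Z x i * Z x j ∂μ = if i = j then t else 0 := fun i j => by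
      have : ∀ x, Z x i * Z x j = t * (Y x i * Y x j) := fun x => by
        simp only [hZ, Pi.smul_apply, smul_eq_mul]
        rw [mul_mul_mul_comm, Real.mul_self_sqrt ht0]
      simp_rw [this, integral_const_mul, hδ]
      split_ifs <;> simp
    have hZρ : ∀ x, Z x ⬝ᵥ Z x ≤ t * D := fun x => by
      simp only [hZ, smul_dotProduct, dotProduct_smul, smul_eq_mul]
      rw [← mul_assoc, Real.mul_self_sqrt ht0]
      exact mul_le_mul_of_nonneg_left (hYD x) ht0
    have h1 := integral_trace_one_add_le μ hZc hZδ ht0 (by positivity) hZρ m M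
    have hpsd : ∀ x : Fin M → Ω, ∀ a : ι → ℝ, 0 ≤ a ⬝ᵥ (1 + sumOuter Z x) *ᵥ a := fun x a => by
      rw [add_mulVec, dotProduct_add, one_mulVec]
      exact add_nonneg (Finset.sum_nonneg fun i _ => mul_self_nonneg _)
        (dotProduct_sumOuter_nonneg Z x a)
    have hherm : ∀ x : Fin M → Ω, (1 + sumOuter Z x).IsHermitian := fun x =>
      isHermitian_one.add (isHermitian_sumOuter Z x)
    have hsub : S ⊆ {x | (1 + θ * (1 + η) / m) ^ m ≤ ((1 + sumOuter Z x) ^ m).trace} := by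
      rintro x ⟨a, ha, hax⟩
      refine le_trace_pow (hherm x) (hpsd x) (by positivity) ha ?_ m
      rw [add_mulVec, dotProduct_add, one_mulVec, dotProduct_sumOuter_smul ht0, add_mul, one_mul]
      have : t * ∑ j, (Y (x j) ⬝ᵥ a) ^ 2 = θ / m * ((M : ℝ)⁻¹ * ∑ j, (Y (x j) ⬝ᵥ a) ^ 2) := by
        rw [ht]; field_simp
      rw [this, mul_div_right_comm, mul_assoc]
      gcongr
    have hcont : Continuous fun x : Fin M → Ω => ((1 + sumOuter Z x) ^ m).trace :=
      ((continuous_const.add (continuous_sumOuter hZc M)).pow m).matrix_trace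
    have hnonneg : ∀ x : Fin M → Ω, 0 ≤ ((1 + sumOuter Z x) ^ m).trace := fun x => by
      obtain ⟨d, hd0, -, htr, -⟩ := (hherm x).exists_moments_of_le (L := 0) (by simpa using hpsd x)
      rw [htr]
      exact Finset.sum_nonneg fun l _ => pow_nonneg (hd0 l) _
    have h2 := mul_meas_ge_le_integral_of_nonneg (μ := Measure.pi fun _ : Fin M => μ)
      (Filter.Eventually.of_forall hnonneg) (Continuous.integrable_of_compactSpace hcont)
      ((1 + θ * (1 + η) / m) ^ m)
    calc _ ≤ _ := mul_le_mul_of_nonneg_left (measureReal_mono hsub) (by positivity)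
      _ ≤ _ := h2
      _ ≤ _ := h1
      _ ≤ _ := by
        gcongr
        have e1 : (1 + t * D) ^ m ≤ Real.exp (θ * D / M) := by
          calc _ ≤ Real.exp (t * D) ^ m := by
                gcongr; linarith [Real.add_one_le_exp (t * D)]
            _ = _ := by rw [← Real.exp_nat_mul]; congr 1; rw [ht]; field_simp
        have e2 : m * (1 + t * D) ^ m * t ≤ θ * Real.exp (θ * D / M) / M := by
          calc m * (1 + t * D) ^ m * t = (1 + t * D) ^ m * (θ / M) := by rw [ht]; field_simp
            _ ≤ Real.exp (θ * D / M) * (θ / M) := by gcongr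
            _ = _ := by ring
        calc _ ≤ Real.exp (θ * Real.exp (θ * D / M) / M) ^ M := by
              gcongr
              linarith [Real.add_one_le_exp (θ * Real.exp (θ * D / M) / M)]
          _ = _ := by rw [← Real.exp_nat_mul]; congr 1; field_simp
  have hlim : Real.exp (θ * (1 + η)) * (Measure.pi fun _ : Fin M => μ).real S ≤
      Fintype.card ι * Real.exp (θ * Real.exp (θ * D / M)) := by
    refine le_of_tendsto ((Real.tendsto_one_add_div_pow_exp (θ * (1 + η))).mul_const _) ?_
    filter_upwards [eventually_gt_atTop 0] with m hm using key m hm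
  have hτ : θ * D / M = η / 4 := by rw [hθ]; field_simp
  have hexp : Real.exp (η / 4) ≤ 1 + η / 2 := by
    have := Real.abs_exp_sub_one_le (x := η / 4) (by rw [abs_of_pos] <;> linarith)
    rw [abs_of_pos (a := η / 4) (by linarith)] at this
    linarith [le_abs_self (Real.exp (η / 4) - 1)]
  rw [← le_div_iff₀' (Real.exp_pos _), mul_div_assoc, ← Real.exp_sub, hτ] at hlim
  refine hlim.trans ?_
  gcongr
  calc θ * Real.exp (η / 4) - θ * (1 + η) ≤ θ * (1 + η / 2) - θ * (1 + η) := by gcongr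
    _ = -(η ^ 2 * M / (8 * D)) := by rw [hθ]; field_simp; ring

-- The same argument with `1 - (θ / (m M)) ∑ Y Yᵀ`. Positivity of this matrix needs `m ≥ 2 θ D`,
-- which is harmless in the limit `m → ∞`.
open Filter Topology in
theorem measure_lower_deviation_le (hY : Continuous Y)
    (hδ : ∀ i j, ∫ x, Y x i * Y x j ∂μ = if i = j then 1 else 0) (hD : 1 ≤ D)
    (hYD : ∀ x, Y x ⬝ᵥ Y x ≤ D) {M : ℕ} (hM : 0 < M) {η : ℝ} (hη : 0 < η) (hη1 : η ≤ 1) :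
    (Measure.pi fun _ : Fin M => μ).real {x | ∃ a : ι → ℝ, a ≠ 0 ∧
      (M : ℝ)⁻¹ * ∑ j, (Y (x j) ⬝ᵥ a) ^ 2 ≤ (1 - η) * (a ⬝ᵥ a)} ≤
      Fintype.card ι * Real.exp (-(η ^ 2 * M / (8 * D))) := by
  set S := {x : Fin M → Ω | ∃ a : ι → ℝ, a ≠ 0 ∧
      (M : ℝ)⁻¹ * ∑ j, (Y (x j) ⬝ᵥ a) ^ 2 ≤ (1 - η) * (a ⬝ᵥ a)}
  have hD0 : 0 < D := one_pos.trans_le hD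
  have hM' : (0 : ℝ) < M := Nat.cast_pos.2 hM
  set θ : ℝ := η * M / (4 * D) with hθ
  have hθ0 : 0 < θ := by positivity
  have key : ∀ m : ℕ, 0 < m → 2 * θ * D ≤ m →
      (1 + -(θ * (1 - η)) / m) ^ m * (Measure.pi fun _ : Fin M => μ).real S ≤
      Fintype.card ι * Real.exp (-(θ * Real.exp (-(2 * (θ * D / M))))) := by
    intro m hm hmθ
    have hm' : (0 : ℝ) < m := Nat.cast_pos.2 hm
    set t : ℝ := θ / (m * M) with ht
    have ht0 : 0 ≤ t := by positivity
    set Z : Ω → ι → ℝ := fun x => √t • Y x with hZ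
    have hZc : Continuous Z := by fun_prop
    have hZδ : ∀ i j, ∫ x, Z x i * Z x j ∂μ = if i = j then t else 0 := fun i j => by
      have : ∀ x, Z x i * Z x j = t * (Y x i * Y x j) := fun x => by
        simp only [hZ, Pi.smul_apply, smul_eq_mul]
        rw [mul_mul_mul_comm, Real.mul_self_sqrt ht0]
      simp_rw [this, integral_const_mul, hδ]
      split_ifs <;> simp
    have hZρ : ∀ x, Z x ⬝ᵥ Z x ≤ t * D := fun x => by
      simp only [hZ, smul_dotProduct, dotProduct_smul, smul_eq_mul]
      rw [← mul_assoc, Real.mul_self_sqrt ht0]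
      exact mul_le_mul_of_nonneg_left (hYD x) ht0
    have htD : M * (t * D) ≤ 1 / 2 := by
      rw [ht, show (M : ℝ) * (θ / (m * M) * D) = θ * D / m by field_simp, div_le_iff₀ hm']
      linarith
    have e1 : Real.exp (-(2 * (θ * D / M))) ≤ ((1 + 2 * (t * D)) ^ m)⁻¹ := by
      rw [Real.exp_neg]
      gcongr
      calc _ ≤ Real.exp (2 * (t * D)) ^ m := by
            gcongr; linarith [Real.add_one_le_exp (2 * (t * D))]
        _ = _ := by rw [← Real.exp_nat_mul]; congr 1; rw [ht]; field_simp
    have hmt : m * t = θ / M := by rw [ht]; field_simp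
    have hinv1 : ((1 + 2 * (t * D)) ^ m)⁻¹ ≤ 1 :=
      inv_le_one_of_one_le₀ (one_le_pow₀ (by nlinarith [mul_nonneg ht0 hD0.le]))
    have hle1 : m * ((1 + 2 * (t * D)) ^ m)⁻¹ * t ≤ 1 := by
      rw [mul_right_comm, hmt, hθ]
      calc _ ≤ η * M / (4 * D) / M * 1 := by gcongr
        _ = η / (4 * D) := by field_simp
        _ ≤ 1 := by rw [div_le_one (by positivity)]; linarith
    have h1 := integral_trace_one_sub_le μ hZc hZδ (by positivity) hZρ m M htD hle1
    have hpsd : ∀ x : Fin M → Ω, ∀ a : ι → ℝ, 0 ≤ a ⬝ᵥ (1 - sumOuter Z x) *ᵥ a := fun x a => by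
      rw [sub_mulVec, dotProduct_sub, one_mulVec]
      have ha : 0 ≤ a ⬝ᵥ a := Finset.sum_nonneg fun i _ => mul_self_nonneg _
      nlinarith [dotProduct_sumOuter_le hZρ x a, mul_le_mul_of_nonneg_right htD ha]
    have hherm : ∀ x : Fin M → Ω, (1 - sumOuter Z x).IsHermitian := fun x =>
      isHermitian_one.sub (isHermitian_sumOuter Z x)
    have hbase : 0 ≤ 1 + -(θ * (1 - η)) / m := by
      have : θ * (1 - η) / m ≤ 1 := by
        rw [div_le_one hm']
        nlinarith [mul_nonneg hθ0.le hη.le, mul_le_mul_of_nonneg_left hD hθ0.le]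
      rw [neg_div]; linarith
    have hsub : S ⊆ {x | (1 + -(θ * (1 - η)) / m) ^ m ≤ ((1 - sumOuter Z x) ^ m).trace} := by
      rintro x ⟨a, ha, hax⟩
      refine le_trace_pow (hherm x) (hpsd x) hbase ha ?_ m
      rw [sub_mulVec, dotProduct_sub, one_mulVec, dotProduct_sumOuter_smul ht0]
      have : t * ∑ j, (Y (x j) ⬝ᵥ a) ^ 2 = θ / m * ((M : ℝ)⁻¹ * ∑ j, (Y (x j) ⬝ᵥ a) ^ 2) := by
        rw [ht]; field_simp
      have h3 : θ / m * ((M : ℝ)⁻¹ * ∑ j, (Y (x j) ⬝ᵥ a) ^ 2) ≤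
          θ / m * ((1 - η) * (a ⬝ᵥ a)) := by gcongr
      rw [this]
      have h4 : (1 + -(θ * (1 - η)) / m) * (a ⬝ᵥ a) =
          a ⬝ᵥ a - θ / m * ((1 - η) * (a ⬝ᵥ a)) := by ring
      linarith
    have hcont : Continuous fun x : Fin M → Ω => ((1 - sumOuter Z x) ^ m).trace :=
      ((continuous_const.sub (continuous_sumOuter hZc M)).pow m).matrix_trace
    have hnonneg : ∀ x : Fin M → Ω, 0 ≤ ((1 - sumOuter Z x) ^ m).trace := fun x => by
      obtain ⟨d, hd0, -, htr, -⟩ := (hherm x).exists_moments_of_le (L := 0) (by simpa using hpsd x)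
      rw [htr]
      exact Finset.sum_nonneg fun l _ => pow_nonneg (hd0 l) _
    have h2 := mul_meas_ge_le_integral_of_nonneg (μ := Measure.pi fun _ : Fin M => μ)
      (Filter.Eventually.of_forall hnonneg) (Continuous.integrable_of_compactSpace hcont)
      ((1 + -(θ * (1 - η)) / m) ^ m)
    calc _ ≤ _ := mul_le_mul_of_nonneg_left (measureReal_mono hsub) (pow_nonneg hbase m)
      _ ≤ _ := h2
      _ ≤ _ := h1
      _ ≤ _ := by
        gcongr
        have e2 : θ * Real.exp (-(2 * (θ * D / M))) / M ≤ m * ((1 + 2 * (t * D)) ^ m)⁻¹ * t := by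
          rw [mul_right_comm, hmt, mul_div_right_comm]
          gcongr
        calc _ ≤ Real.exp (-(θ * Real.exp (-(2 * (θ * D / M))) / M)) ^ M := by
              refine pow_le_pow_left₀ (sub_nonneg.2 hle1) ?_ M
              linarith [Real.add_one_le_exp (-(θ * Real.exp (-(2 * (θ * D / M))) / M))]
          _ = _ := by rw [← Real.exp_nat_mul]; congr 1; field_simp
  have hlim : Real.exp (-(θ * (1 - η))) * (Measure.pi fun _ : Fin M => μ).real S ≤
      Fintype.card ι * Real.exp (-(θ * Real.exp (-(2 * (θ * D / M))))) := by
    refine le_of_tendsto ((Real.tendsto_one_add_div_pow_exp (-(θ * (1 - η)))).mul_const _) ?_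
    filter_upwards [eventually_gt_atTop 0, tendsto_natCast_atTop_atTop.eventually_ge_atTop
      (2 * θ * D)] with m hm hm2 using key m hm hm2
  have hτ : θ * D / M = η / 4 := by rw [hθ]; field_simp
  have hexp : 1 - η / 2 ≤ Real.exp (-(2 * (η / 4))) := by
    linarith [Real.add_one_le_exp (-(2 * (η / 4)))]
  rw [← le_div_iff₀' (Real.exp_pos _), mul_div_assoc, ← Real.exp_sub, hτ] at hlim
  refine hlim.trans ?_
  gcongr
  calc -(θ * Real.exp (-(2 * (η / 4)))) - -(θ * (1 - η))
      ≤ -(θ * (1 - η / 2)) - -(θ * (1 - η)) := by gcongr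
    _ = -(η ^ 2 * M / (8 * D)) := by rw [hθ]; field_simp; ring

end RandomSum

/-! ### Rotation invariance and spherical polynomials -/

section Sphere

variable {q : ℕ}

instance isProbabilityMeasure_muSph (q : ℕ) : IsProbabilityMeasure (muSph q) := by
  have : NeZero (volume : Measure (EuclideanSpace ℝ (Fin (q + 1)))).toSphere :=
    ⟨Measure.toSphere_ne_zero _⟩
  exact isProbabilityMeasureSMul

instance isOpenPosMeasure_muSph (q : ℕ) : (muSph q).IsOpenPosMeasure := by
  unfold muSph
  refine ⟨fun U hU hne => ?_⟩
  rw [Measure.smul_apply, smul_eq_mul]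
  exact mul_ne_zero (ENNReal.inv_ne_zero.2 (measure_ne_top _ _)) (hU.measure_ne_zero _ hne)

/-- The action of a linear isometry on the unit sphere. -/
noncomputable def sphMap (g : EuclideanSpace ℝ (Fin (q + 1)) ≃ₗᵢ[ℝ] EuclideanSpace ℝ (Fin (q + 1)))
    (x : Sph q) : Sph q :=
  ⟨g x.1, by simp⟩

theorem continuous_sphMap
    (g : EuclideanSpace ℝ (Fin (q + 1)) ≃ₗᵢ[ℝ] EuclideanSpace ℝ (Fin (q + 1))) :
    Continuous (sphMap g) :=
  (g.continuous.comp continuous_subtype_val).subtype_mk _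

/-- The surface measure of `s` is a multiple of the volume of the cone over `s`, and a linear
isometry preserves volume and commutes with forming cones. -/
theorem measurePreserving_sphMap
    (g : EuclideanSpace ℝ (Fin (q + 1)) ≃ₗᵢ[ℝ] EuclideanSpace ℝ (Fin (q + 1))) :
    MeasurePreserving (sphMap g) (muSph q) (muSph q) := by
  refine ⟨(continuous_sphMap g).measurable, Measure.ext fun s hs => ?_⟩
  rw [Measure.map_apply (continuous_sphMap g).measurable hs]
  simp only [muSph, Measure.smul_apply]
  rw [Measure.toSphere_apply' _ hs,
    Measure.toSphere_apply' _ ((continuous_sphMap g).measurable hs)]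
  congr 2
  refine Eq.trans ?_
    (g.measurePreserving.measure_preimage_emb g.toHomeomorph.measurableEmbedding _)
  congr 1
  ext y
  simp only [Set.mem_smul, Set.mem_image, Set.mem_preimage]
  constructor
  · rintro ⟨r, hr, _, ⟨x, hx, rfl⟩, rfl⟩
    exact ⟨r, hr, _, ⟨_, hx, rfl⟩, by simp [sphMap]⟩
  · rintro ⟨r, hr, _, ⟨x, hx, rfl⟩, h⟩
    refine ⟨r, hr, _, ⟨sphMap g.symm x, ?_, rfl⟩, ?_⟩
    · have : sphMap g (sphMap g.symm x) = x := Subtype.ext (by simp [sphMap])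
      rwa [this]
    · apply g.injective
      simpa [sphMap] using h

/-- The reflection in the hyperplane orthogonal to `z - x` exchanges these two vectors of equal
norm. -/
theorem exists_sphMap_eq (x z : Sph q) :
    ∃ g : EuclideanSpace ℝ (Fin (q + 1)) ≃ₗᵢ[ℝ] EuclideanSpace ℝ (Fin (q + 1)),
      sphMap g z = x :=
  ⟨_, Subtype.ext (Submodule.reflection_sub (v := z.1) (w := x.1) (by simp))⟩

theorem integral_comp_sphMap
    (g : EuclideanSpace ℝ (Fin (q + 1)) ≃ₗᵢ[ℝ] EuclideanSpace ℝ (Fin (q + 1)))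
    {f : Sph q → ℝ} (hf : Continuous f) :
    ∫ x, f (sphMap g x) ∂(muSph q) = ∫ x, f x ∂(muSph q) := by
  conv_rhs => rw [← (measurePreserving_sphMap g).map_eq]
  rw [integral_map (continuous_sphMap g).aemeasurable hf.aestronglyMeasurable]

/-- Restriction of polynomials to the sphere, as a linear map. -/
noncomputable def evalSphₗ (q : ℕ) : MvPolynomial (Fin (q + 1)) ℝ →ₗ[ℝ] (Sph q → ℝ) where
  toFun := evalSph
  map_add' p r := by ext x; simp [evalSph]
  map_smul' c p := by ext x; simp [evalSph, MvPolynomial.smul_eval]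

/-- Restrictions to the sphere of homogeneous polynomials of degree `l`. -/
noncomputable def homSph (q l : ℕ) : Submodule ℝ (Sph q → ℝ) :=
  (MvPolynomial.homogeneousSubmodule (Fin (q + 1)) ℝ l).map (evalSphₗ q)

/-- `Π_n^q` as a submodule. -/
noncomputable def piSub (q n : ℕ) : Submodule ℝ (Sph q → ℝ) :=
  (MvPolynomial.restrictTotalDegree (Fin (q + 1)) ℝ n).map (evalSphₗ q)

theorem mem_piSub {n : ℕ} {f : Sph q → ℝ} : f ∈ piSub q n ↔ f ∈ PiSph q n := by
  simp only [piSub, PiSph, Submodule.mem_map, MvPolynomial.mem_restrictTotalDegree,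
    Set.mem_ofPred_eq]
  exact exists_congr fun p => and_congr Iff.rfl eq_comm

theorem continuous_evalSph (p : MvPolynomial (Fin (q + 1)) ℝ) : Continuous (evalSph p) := by
  unfold evalSph
  exact (MvPolynomial.continuous_eval p).comp (by fun_prop)

theorem continuous_of_mem_piSub {n : ℕ} {f : Sph q → ℝ} (hf : f ∈ piSub q n) : Continuous f := by
  obtain ⟨p, -, rfl⟩ := hf
  exact continuous_evalSph p

theorem homSph_le_piSub {l n : ℕ} (h : l ≤ n) : homSph q l ≤ piSub q n := by
  rintro _ ⟨p, hp, rfl⟩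
  refine ⟨p, ?_, rfl⟩
  rw [SetLike.mem_coe, MvPolynomial.mem_restrictTotalDegree]
  exact (MvPolynomial.IsHomogeneous.totalDegree_le hp).trans h

theorem sum_sq_sphere (x : Sph q) : ∑ i, x.1 i ^ 2 = 1 := by
  have := x.2
  rw [mem_sphere_zero_iff_norm, EuclideanSpace.norm_eq, Real.sqrt_eq_one] at this
  simpa using this

open MvPolynomial in
theorem homSph_le_add_two_mul (l j : ℕ) : homSph q l ≤ homSph q (l + 2 * j) := by
  rintro _ ⟨p, hp, rfl⟩
  have h2 : (∑ i : Fin (q + 1), X i ^ 2 : MvPolynomial (Fin (q + 1)) ℝ).IsHomogeneous 2 :=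
    IsHomogeneous.sum _ _ _ fun i _ => by simpa using (isHomogeneous_X ℝ i).pow 2
  refine ⟨p * (∑ i, X i ^ 2) ^ j, IsHomogeneous.mul hp (h2.pow j), ?_⟩
  ext x
  simp [evalSphₗ, evalSph, sum_sq_sphere]

/-- On the sphere `∑ x_i² = 1`, so a homogeneous component may be raised by any even degree, up to
`n` or `n - 1` according to parity. This yields both the dimension bound and rotation invariance. -/
theorem piSub_eq_sup {n : ℕ} (hn : 1 ≤ n) : piSub q n = homSph q n ⊔ homSph q (n - 1) := by
  refine le_antisymm ?_ (sup_le (homSph_le_piSub le_rfl) (homSph_le_piSub (by omega)))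
  rintro _ ⟨p, hp, rfl⟩
  rw [SetLike.mem_coe, MvPolynomial.mem_restrictTotalDegree] at hp
  rw [← MvPolynomial.sum_homogeneousComponent p, map_sum]
  refine Submodule.sum_mem _ fun i hi => ?_
  have hi : i ≤ n := by have := Finset.mem_range.1 hi; omega
  have hmem : evalSphₗ q (MvPolynomial.homogeneousComponent i p) ∈ homSph q i :=
    ⟨_, MvPolynomial.homogeneousComponent_isHomogeneous i p, rfl⟩
  obtain ⟨j, hj | hj⟩ : ∃ j, n = i + 2 * j ∨ n - 1 = i + 2 * j := by
    rcases Nat.even_or_odd' (n - i) with ⟨j, hj | hj⟩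
    · exact ⟨j, Or.inl (by omega)⟩
    · exact ⟨j, Or.inr (by omega)⟩
  · exact Submodule.mem_sup_left (hj ▸ homSph_le_add_two_mul i j hmem)
  · exact Submodule.mem_sup_right (hj ▸ homSph_le_add_two_mul i j hmem)

theorem homSph_comp_sphMap {l : ℕ} {f : Sph q → ℝ} (hf : f ∈ homSph q l)
    (g : EuclideanSpace ℝ (Fin (q + 1)) ≃ₗᵢ[ℝ] EuclideanSpace ℝ (Fin (q + 1))) :
    f ∘ sphMap g ∈ homSph q l := by
  obtain ⟨p, hp, rfl⟩ := hf
  set L : Fin (q + 1) → MvPolynomial (Fin (q + 1)) ℝ := fun i =>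
    ∑ j, MvPolynomial.C (g (EuclideanSpace.single j 1) i) * MvPolynomial.X j with hL
  have hLh : ∀ i, (L i).IsHomogeneous 1 := fun i =>
    MvPolynomial.IsHomogeneous.sum _ _ _ fun j _ => by
      simpa using (MvPolynomial.isHomogeneous_C _ _).mul (MvPolynomial.isHomogeneous_X ℝ j)
  refine ⟨MvPolynomial.aeval L p, by simpa using MvPolynomial.IsHomogeneous.aeval hp L hLh, ?_⟩
  ext x
  have hx : ∀ i, MvPolynomial.eval (fun i => x.1 i) (L i) = (sphMap g x).1 i := by
    intro i
    have : x.1 = ∑ j, x.1 j • EuclideanSpace.single j (1 : ℝ) := by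
      ext i; simp [Finset.sum_apply, Pi.single_apply]
    simp only [hL, sphMap, map_sum, map_mul, MvPolynomial.eval_C, MvPolynomial.eval_X]
    conv_rhs => rw [this, map_sum]
    simp [mul_comm]
  simp only [evalSphₗ, LinearMap.coe_mk, AddHom.coe_mk, evalSph, Function.comp]
  rw [← funext hx]
  simp only [← MvPolynomial.coe_aeval_eq_eval, RingHom.coe_coe]
  exact MvPolynomial.comp_aeval_apply _ _ _

theorem piSub_comp_sphMap {n : ℕ} (hn : 1 ≤ n) {f : Sph q → ℝ} (hf : f ∈ piSub q n)
    (g : EuclideanSpace ℝ (Fin (q + 1)) ≃ₗᵢ[ℝ] EuclideanSpace ℝ (Fin (q + 1))) :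
    f ∘ sphMap g ∈ piSub q n := by
  rw [piSub_eq_sup hn] at hf ⊢
  obtain ⟨a, ha, b, hb, rfl⟩ := Submodule.mem_sup.1 hf
  exact Submodule.add_mem_sup (homSph_comp_sphMap ha g) (homSph_comp_sphMap hb g)

theorem finrank_homogeneousSubmodule (q l : ℕ) :
    Module.finrank ℝ (MvPolynomial.homogeneousSubmodule (Fin (q + 1)) ℝ l) = (l + q).choose q := by
  rw [MvPolynomial.homogeneousSubmodule_eq_finsupp_supported,
    Module.finrank_eq_nat_card_basis ⟨AddMonoidAlgebra.supportedEquivFinsupp ..⟩]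
  have : {d : Fin (q + 1) →₀ ℕ | d.degree = l} =
      ((Finset.univ : Finset (Fin (q + 1))).finsuppAntidiag l : Set (Fin (q + 1) →₀ ℕ)) := by
    ext d
    simp [Finset.mem_finsuppAntidiag, Finsupp.degree_eq_sum]
  rw [this, Nat.card_coe_set_eq, Set.ncard_coe_finset,
    Finset.card_finsuppAntidiag_nat_eq_choose, Finset.card_univ, Fintype.card_fin,
    show q + 1 + l - 1 = l + q by omega, Nat.choose_symm_add]

instance finiteDimensional_homogeneousSubmodule (q l : ℕ) :
    FiniteDimensional ℝ (MvPolynomial.homogeneousSubmodule (Fin (q + 1)) ℝ l) :=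
  Module.Finite.iff_fg.2 (MvPolynomial.homogeneousSubmodule_fg _ _ l)

instance finiteDimensional_homSph (q l : ℕ) : FiniteDimensional ℝ (homSph q l) := by
  unfold homSph; infer_instance

theorem finiteDimensional_piSub (q : ℕ) {n : ℕ} (hn : 1 ≤ n) : FiniteDimensional ℝ (piSub q n) := by
  rw [piSub_eq_sup hn]; infer_instance

theorem choose_add_le_pow (q n : ℕ) : (n + q).choose q ≤ (n + 1) ^ q := by
  induction q with
  | zero => simp
  | succ q ih =>
    have h := Nat.add_one_mul_choose_eq (n + q) q
    rw [pow_succ]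
    refine Nat.le_of_mul_le_mul_right (c := q + 1) ?_ (by omega)
    rw [show n + (q + 1) = n + q + 1 by ring, ← h]
    nlinarith [Nat.zero_le (n * q), Nat.mul_le_mul_left (n + q + 1) ih]

theorem finrank_piSub_le (q : ℕ) {n : ℕ} (hn : 1 ≤ n) :
    Module.finrank ℝ (piSub q n) ≤ 2 ^ (q + 1) * n ^ q := by
  have h : ∀ l, Module.finrank ℝ (homSph q l) ≤ (l + 1) ^ q := fun l =>
    (Submodule.finrank_map_le _ _).trans
      ((finrank_homogeneousSubmodule q l).trans_le (choose_add_le_pow q l))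
  rw [piSub_eq_sup hn]
  refine (Submodule.finrank_add_le_finrank_add_finrank _ _).trans ?_
  have h1 : (n + 1) ^ q ≤ 2 ^ q * n ^ q := by
    rw [← mul_pow]; exact Nat.pow_le_pow_left (by omega) q
  have h2 : (n - 1 + 1) ^ q ≤ (n + 1) ^ q := Nat.pow_le_pow_left (by omega) q
  rw [pow_succ]
  linarith [h n, h (n - 1)]

end Sphere

/-! ### Orthonormal bases and the Christoffel function -/

section Basis

open Matrix

/-- The quadratic form of a Gram matrix. -/
theorem integral_sq_sum {X ι : Type*} [Fintype ι] [TopologicalSpace X] [CompactSpace X]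
    [MeasurableSpace X] [OpensMeasurableSpace X] (ν : Measure X) [IsFiniteMeasure ν]
    {f : ι → X → ℝ} (hf : ∀ i, Continuous (f i)) (a : ι → ℝ) :
    ∫ x, (∑ i, a i * f i x) ^ 2 ∂ν =
      a ⬝ᵥ (Matrix.of fun i j => ∫ x, f i x * f j x ∂ν) *ᵥ a := by
  have hint : ∀ i j, Integrable (fun x => a i * f i x * (a j * f j x)) ν := fun i j =>
    Continuous.integrable_of_compactSpace (by have := hf i; have := hf j; fun_prop)
  simp only [sq, Finset.sum_mul_sum]
  rw [integral_finsetSum _ fun i _ => integrable_finsetSum _ fun j _ => hint i j]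
  simp_rw [integral_finsetSum _ fun j _ => hint _ j]
  simp only [dotProduct, mulVec, Matrix.of_apply, Finset.mul_sum]
  refine Finset.sum_congr rfl fun i _ => Finset.sum_congr rfl fun j _ => ?_
  rw [← integral_mul_const, ← integral_const_mul]
  congr 1; ext x; ring

variable {q : ℕ}

theorem integral_sq_sum_orthonormal {ι : Type*} [Fintype ι] [DecidableEq ι] {f : ι → Sph q → ℝ}
    (hf : ∀ i, Continuous (f i))
    (ho : ∀ i j, ∫ x, f i x * f j x ∂(muSph q) = if i = j then 1 else 0) (a : ι → ℝ) :
    ∫ x, (∑ i, a i * f i x) ^ 2 ∂(muSph q) = a ⬝ᵥ a := by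
  rw [integral_sq_sum _ hf]
  have : (Matrix.of fun i j => ∫ x, f i x * f j x ∂(muSph q)) = 1 := by
    ext i j; simp [ho, Matrix.one_apply]
  rw [this, one_mulVec]

theorem integral_sq_pos {f : Sph q → ℝ} (hf : Continuous f) (h0 : f ≠ 0) :
    0 < ∫ x, f x ^ 2 ∂(muSph q) := by
  obtain ⟨x, hx⟩ := Function.ne_iff.1 h0
  exact (hf.pow 2).integral_pos_of_hasCompactSupport_nonneg_nonzero
    (HasCompactSupport.of_compactSpace _) (fun x => sq_nonneg _) (pow_ne_zero 2 hx)

/-- The inner product of `L²(μ_q)` on spherical polynomials. -/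
noncomputable def innerPi (q n : ℕ) : LinearMap.BilinForm ℝ (piSub q n) :=
  LinearMap.mk₂ ℝ (fun f g => ∫ x, f.1 x * g.1 x ∂(muSph q))
    (fun f g h => by
      have hf := continuous_of_mem_piSub f.2
      have hg := continuous_of_mem_piSub g.2
      have hh := continuous_of_mem_piSub h.2
      simp only [Submodule.coe_add, Pi.add_apply, add_mul]
      exact integral_add (Continuous.integrable_of_compactSpace (hf.mul hh))
        (Continuous.integrable_of_compactSpace (hg.mul hh)))
    (fun c f g => by
      rw [smul_eq_mul, ← integral_const_mul]
      simp [mul_assoc])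
    (fun f g h => by
      have hf := continuous_of_mem_piSub f.2
      have hg := continuous_of_mem_piSub g.2
      have hh := continuous_of_mem_piSub h.2
      simp only [Submodule.coe_add, Pi.add_apply, mul_add]
      exact integral_add (Continuous.integrable_of_compactSpace (hf.mul hg))
        (Continuous.integrable_of_compactSpace (hf.mul hh)))
    (fun c f g => by
      rw [smul_eq_mul, ← integral_const_mul]
      simp [mul_left_comm])

/-- An orthogonal basis for the symmetric form is normalised; the norms are positive because `μ_q`
charges every nonempty open set. -/
theorem exists_orthonormal_piSub (q : ℕ) {n : ℕ} (hn : 1 ≤ n) :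
    ∃ e : Fin (Module.finrank ℝ (piSub q n)) → Sph q → ℝ, (∀ i, e i ∈ piSub q n) ∧
      (∀ i j, ∫ x, e i x * e j x ∂(muSph q) = if i = j then 1 else 0) ∧
      ∀ f ∈ piSub q n, ∃ a : Fin (Module.finrank ℝ (piSub q n)) → ℝ,
        ∀ x, f x = ∑ i, a i * e i x := by
  have := finiteDimensional_piSub q hn
  have hsymm : LinearMap.IsSymm (innerPi q n) := ⟨fun f g => by
    simp only [innerPi, LinearMap.mk₂_apply, RingHom.id_apply, mul_comm]⟩
  have : Invertible (2 : ℝ) := invertibleOfNonzero two_ne_zero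
  obtain ⟨v, hv⟩ := LinearMap.BilinForm.exists_orthogonal_basis (B := innerPi q n) hsymm
  set s : Fin (Module.finrank ℝ (piSub q n)) → ℝ := fun i => ∫ x, (v i).1 x ^ 2 ∂(muSph q) with hs
  have hs0 : ∀ i, 0 < s i := fun i =>
    integral_sq_pos (continuous_of_mem_piSub (v i).2) fun h => v.ne_zero i (Subtype.ext h)
  refine ⟨fun i => (√(s i))⁻¹ • (v i).1, fun i => Submodule.smul_mem _ _ (v i).2, fun i j => ?_,
    fun f hf => ⟨fun i => v.repr ⟨f, hf⟩ i * √(s i), fun x => ?_⟩⟩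
  · have e : ∀ x, ((√(s i))⁻¹ • (v i).1) x * ((√(s j))⁻¹ • (v j).1) x =
        (√(s i))⁻¹ * (√(s j))⁻¹ * ((v i).1 x * (v j).1 x) := fun x => by
      simp only [Pi.smul_apply, smul_eq_mul]; ring
    simp_rw [e, integral_const_mul]
    split_ifs with h
    · subst h
      simp_rw [← sq (_ : ℝ)]
      rw [inv_pow, Real.sq_sqrt (hs0 i).le]
      exact inv_mul_cancel₀ (hs0 i).ne'
    · have := hv h
      simp only [innerPi, Function.onFun] at this
      exact mul_eq_zero_of_right _ this
  · have h1 := congrArg (fun g : piSub q n => g.1 x) (v.sum_repr ⟨f, hf⟩)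
    simp only [Submodule.coe_sum, Finset.sum_apply, Submodule.coe_smul, Pi.smul_apply,
      smul_eq_mul] at h1
    rw [← h1]
    refine Finset.sum_congr rfl fun i _ => ?_
    have := (Real.sqrt_pos.2 (hs0 i)).ne'
    simp only [Pi.smul_apply, smul_eq_mul]
    field_simp

/-- The Christoffel function of `Π_n^q` is constant. -/
theorem sum_sq_eq_finrank {n : ℕ} (hn : 1 ≤ n)
    {e : Fin (Module.finrank ℝ (piSub q n)) → Sph q → ℝ} (he : ∀ i, e i ∈ piSub q n)
    (ho : ∀ i j, ∫ x, e i x * e j x ∂(muSph q) = if i = j then 1 else 0)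
    (hspan : ∀ f ∈ piSub q n, ∃ a : Fin (Module.finrank ℝ (piSub q n)) → ℝ,
        ∀ x, f x = ∑ i, a i * e i x) (x : Sph q) :
    ∑ i, e i x ^ 2 = Module.finrank ℝ (piSub q n) := by
  have hc : ∀ i, Continuous (e i) := fun i => continuous_of_mem_piSub (he i)
  have hle : ∀ x z, ∑ i, e i x ^ 2 ≤ ∑ i, e i z ^ 2 := by
    intro x z
    obtain ⟨g, rfl⟩ := exists_sphMap_eq x z
    set x := sphMap g z with hx
    -- `F` is the reproducing kernel at `x = g z`, with squared norm `K(x) = F(x)`. Rotating it and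
    -- evaluating at `z`, Cauchy–Schwarz gives `K(x)² ≤ K(x) K(z)`.
    set F : Sph q → ℝ := ∑ i, e i x • e i with hF
    have hFx : ∀ y, F y = ∑ i, e i x * e i y := fun y => by simp [hF, Finset.sum_apply]
    have hFm : F ∈ piSub q n := Submodule.sum_mem _ fun i _ => Submodule.smul_mem _ _ (he i)
    obtain ⟨a, ha⟩ := hspan _ (piSub_comp_sphMap hn hFm g)
    have h1 : ∫ y, F y ^ 2 ∂(muSph q) = ∑ i, e i x ^ 2 := by
      simp_rw [hFx]
      rw [integral_sq_sum_orthonormal hc ho]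
      simp [dotProduct, sq]
    have h2 : ∫ y, F y ^ 2 ∂(muSph q) = ∑ i, a i ^ 2 := by
      rw [← integral_comp_sphMap g (f := fun y => F y ^ 2)
        ((continuous_of_mem_piSub hFm).pow 2)]
      have : ∀ y, F (sphMap g y) = ∑ i, a i * e i y := ha
      simp_rw [this]
      rw [integral_sq_sum_orthonormal hc ho]
      simp [dotProduct, sq]
    have h3 : ∑ i, e i x ^ 2 = ∑ i, a i * e i z := by
      rw [← ha z, Function.comp, ← hx, hFx]
      simp [sq]
    have h4 := Finset.sum_mul_sq_le_sq_mul_sq Finset.univ a fun i => e i z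
    rw [← h3, ← h2, h1, sq] at h4
    rcases (Finset.sum_nonneg fun i _ => sq_nonneg (e i x) :
      0 ≤ ∑ i, e i x ^ 2).eq_or_lt with h0 | h0
    · rw [← h0]; exact Finset.sum_nonneg fun i _ => sq_nonneg _
    · exact le_of_mul_le_mul_left h4 h0
  have hconst : ∀ z, ∑ i, e i z ^ 2 = ∑ i, e i x ^ 2 := fun z => le_antisymm (hle _ _) (hle _ _)
  have hI : ∫ z, ∑ i, e i z ^ 2 ∂(muSph q) = Module.finrank ℝ (piSub q n) := by
    simp_rw [sq]
    rw [integral_finsetSum (f := fun i z => e i z * e i z) _ fun i _ =>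
      Continuous.integrable_of_compactSpace ((hc i).mul (hc i))]
    simp_rw [ho]
    simp
  simpa [hconst] using hI

/-- The sharp `L²` to `L^∞` inequality for spherical polynomials. -/
theorem sq_le_finrank_mul_integral {n : ℕ} (hn : 1 ≤ n) {f : Sph q → ℝ} (hf : f ∈ piSub q n)
    (x : Sph q) : f x ^ 2 ≤ Module.finrank ℝ (piSub q n) * ∫ y, f y ^ 2 ∂(muSph q) := by
  obtain ⟨e, he, ho, hspan⟩ := exists_orthonormal_piSub q hn
  obtain ⟨a, ha⟩ := hspan f hf
  have h1 := Finset.sum_mul_sq_le_sq_mul_sq Finset.univ a fun i => e i x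
  rw [sum_sq_eq_finrank hn he ho hspan x, ← ha x, mul_comm] at h1
  have h2 : ∫ y, f y ^ 2 ∂(muSph q) = ∑ i, a i ^ 2 := by
    simp_rw [ha]
    rw [integral_sq_sum_orthonormal (fun i => continuous_of_mem_piSub (he i)) ho]
    simp [dotProduct, sq]
  rwa [h2]

/-- The `L²` to `L^∞` inequality is tested on the constant `1`. -/
theorem finrank_piSub_pos (q : ℕ) {n : ℕ} (hn : 1 ≤ n) : 1 ≤ Module.finrank ℝ (piSub q n) := by
  have := finiteDimensional_piSub q hn
  have h1 : (fun _ => 1 : Sph q → ℝ) ∈ piSub q n := by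
    rw [mem_piSub]
    exact ⟨1, by simp, by ext x; simp [evalSph]⟩
  have h := sq_le_finrank_mul_integral hn h1 ⟨EuclideanSpace.single 0 1, by simp⟩
  simpa using h

end Basis

/-! ### Dimension count for spherical harmonics -/

section Dimension

open MvPolynomial

variable {q : ℕ}

/-- The Laplace operator on polynomials. -/
noncomputable def laplacianPoly (q : ℕ) :
    MvPolynomial (Fin (q + 1)) ℝ →ₗ[ℝ] MvPolynomial (Fin (q + 1)) ℝ :=
  ∑ i, (pderiv i).toLinearMap ∘ₗ (pderiv i).toLinearMap

theorem laplacianPoly_apply (p : MvPolynomial (Fin (q + 1)) ℝ) :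
    laplacianPoly q p = ∑ i, pderiv i (pderiv i p) := by
  simp [laplacianPoly, LinearMap.sum_apply]

/-- Harmonic homogeneous polynomials. -/
noncomputable def harmPoly (q l : ℕ) : Submodule ℝ (MvPolynomial (Fin (q + 1)) ℝ) :=
  homogeneousSubmodule (Fin (q + 1)) ℝ l ⊓ LinearMap.ker (laplacianPoly q)

instance finiteDimensional_harmPoly (q l : ℕ) : FiniteDimensional ℝ (harmPoly q l) :=
  Submodule.finiteDimensional_of_le inf_le_left

/-- Rank–nullity for the Laplacian from degree `l + 2` to degree `l`. Only a lower bound for the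
kernel is needed, so surjectivity plays no role. -/
theorem choose_le_finrank_harmPoly_add (q l : ℕ) :
    (l + 2 + q).choose q ≤ Module.finrank ℝ (harmPoly q (l + 2)) + (l + q).choose q := by
  rw [← finrank_homogeneousSubmodule q (l + 2), ← finrank_homogeneousSubmodule q l]
  set S := homogeneousSubmodule (Fin (q + 1)) ℝ (l + 2)
  have h := LinearMap.finrank_range_add_finrank_ker ((laplacianPoly q).domRestrict S)
  have h1 : Module.finrank ℝ (LinearMap.range ((laplacianPoly q).domRestrict S)) ≤
      Module.finrank ℝ (homogeneousSubmodule (Fin (q + 1)) ℝ l) := by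
    refine Submodule.finrank_mono ?_
    rintro _ ⟨p, rfl⟩
    rw [LinearMap.domRestrict_apply, laplacianPoly_apply]
    refine Submodule.sum_mem _ fun i _ => ?_
    have := (IsHomogeneous.pderiv (i := i) (IsHomogeneous.pderiv (i := i) p.2))
    simpa using this
  have h2 : Module.finrank ℝ (LinearMap.ker ((laplacianPoly q).domRestrict S)) ≤
      Module.finrank ℝ (harmPoly q (l + 2)) := by
    rw [← Submodule.finrank_map_subtype_eq S]
    refine Submodule.finrank_mono ?_
    rintro _ ⟨p, hp, rfl⟩
    exact ⟨p.2, hp⟩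
  omega

theorem harmPoly_eq_of_le_one {l : ℕ} (hl : l ≤ 1) :
    harmPoly q l = homogeneousSubmodule (Fin (q + 1)) ℝ l := by
  refine inf_eq_left.2 fun p hp => ?_
  rw [LinearMap.mem_ker, laplacianPoly_apply]
  refine Finset.sum_eq_zero fun i _ => ?_
  have h1 := IsHomogeneous.pderiv (i := i) hp
  rw [show l - 1 = 0 by omega] at h1
  have h2 := (totalDegree_eq_zero_iff_eq_C).1 (Nat.le_zero.1 h1.totalDegree_le)
  rw [h2, pderiv_C]

theorem choose_add_choose_le_sum_finrank (q : ℕ) (n : ℕ) :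
    (n + 1 + q).choose q + (n + q).choose q ≤
      ∑ l ∈ Finset.range (n + 2), Module.finrank ℝ (harmPoly q l) := by
  induction n with
  | zero =>
    rw [Finset.sum_range_succ, Finset.sum_range_one, harmPoly_eq_of_le_one le_rfl,
      harmPoly_eq_of_le_one zero_le_one, finrank_homogeneousSubmodule,
      finrank_homogeneousSubmodule]
    simp [add_comm]
  | succ n ih =>
    rw [Finset.sum_range_succ]
    have := choose_le_finrank_harmPoly_add q n
    rw [show n + 1 + 1 + q = n + 2 + q by ring]
    omega

/-- Matches the closed formula for `d_{n+1}^{q+1}` with the telescoped sum of the lower bounds for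
the harmonic dimensions. -/
theorem harmDim_succ_le (q n : ℕ) :
    harmDim (q + 1) (n + 1) ≤ (n + 1 + q).choose q + (n + q).choose q := by
  have h := Nat.add_one_mul_choose_eq (n + q) n
  rw [harmDim, if_neg (by omega), show 2 * (n + 1) + (q + 1) - 1 = 2 * (n + 1) + q by omega,
    show n + 1 + (q + 1) - 1 = n + 1 + q by omega]
  refine Nat.div_le_of_le_mul ?_
  rw [Nat.choose_symm_add, show (n + q).choose q = (n + q).choose n from Nat.choose_symm_add.symm]
  rw [show n + q + 1 = n + 1 + q by ring, Nat.choose_symm_add (a := n + 1)] at h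
  rw [mul_add (n + 1 + q), h]
  exact le_of_eq (by ring)

/-- By homogeneity, vanishing on the sphere propagates along rays to the whole space. -/
theorem evalSph_injOn_homogeneous {l : ℕ} {p : MvPolynomial (Fin (q + 1)) ℝ}
    (hp : p.IsHomogeneous l) (h : evalSph p = 0) : p = 0 := by
  have key : ∀ (r : ℝ) (x : Sph q), eval (fun i => r * x.1 i) p = 0 := by
    intro r x
    have h1 : eval (fun i => r * x.1 i) p = r ^ l * eval (fun i => x.1 i) p := by
      rw [eval_eq, eval_eq, Finset.mul_sum]
      refine Finset.sum_congr rfl fun d hd => ?_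
      have hdeg : ∑ i, d i = l := by
        rw [← Finsupp.degree_eq_sum, Finsupp.degree_eq_weight_one]
        exact hp (mem_support_iff.1 hd)
      have : ∏ i ∈ d.support, (r * x.1 i) ^ d i = r ^ l * ∏ i ∈ d.support, x.1 i ^ d i := by
        simp_rw [mul_pow]
        rw [Finset.prod_mul_distrib, Finset.prod_pow_eq_pow_sum, ← hdeg]
        congr 2
        exact Finset.sum_subset (Finset.subset_univ _) fun i _ hi => by simpa using hi
      rw [this]; ring
    rw [h1]
    have := congrFun h x
    simp only [evalSph, Pi.zero_apply] at this
    rw [this, mul_zero]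
  refine MvPolynomial.funext fun v => ?_
  rw [map_zero]
  set w : EuclideanSpace ℝ (Fin (q + 1)) := WithLp.toLp 2 v with hw
  by_cases hv : w = 0
  · have : v = fun i => 0 * (⟨EuclideanSpace.single 0 1, by simp⟩ : Sph q).1 i := by
      ext i
      simpa [hw] using congrArg (fun z : EuclideanSpace ℝ (Fin (q + 1)) => z i) hv
    rw [this]; exact key 0 _
  · have hn : ‖w‖ ≠ 0 := norm_ne_zero_iff.2 hv
    have : v = fun i => ‖w‖ * (⟨‖w‖⁻¹ • w, by simp [norm_smul, hn]⟩ : Sph q).1 i := by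
      ext i
      rw [PiLp.smul_apply, smul_eq_mul, mul_inv_cancel_left₀ hn]
    rw [this]; exact key _ _

/-- The first `d_n^{q+1}` elements of a harmonic basis have degree at most `n`. -/
theorem IsHarmonicBasis.deg_le {deg : ℕ → ℕ} {y : ℕ → Sph q → ℝ} (hy : IsHarmonicBasis q deg y)
    {n : ℕ} (hn : 1 ≤ n) {k : ℕ} (hk : k < harmDim (q + 1) n) : deg k ≤ n := by
  classical
  by_contra! hdeg
  obtain ⟨n, rfl⟩ : ∃ m, n = m + 1 := ⟨n - 1, by omega⟩
  -- If `y k` had too large a degree, all basis elements of degree at most `n + 1` would precede it.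
  -- They span every harmonic space up to that degree, so there are at least `d_{n+1}^{q+1} > k` of
  -- them.
  have hlt : ∀ i, deg i ≤ n + 1 → i < k := fun i hi => by
    by_contra! h
    have := hy.mono h
    omega
  have hcard : ∀ l ∈ Finset.range (n + 2), Module.finrank ℝ (harmPoly q l) ≤
      ((Finset.range k).filter fun i => deg i = l).card := by
    intro l hl
    have hl := Finset.mem_range.1 hl
    have hinj : Function.Injective ((evalSphₗ q).domRestrict (harmPoly q l)) := by
      rw [← LinearMap.ker_eq_bot, LinearMap.ker_eq_bot']
      intro p hp
      exact Subtype.ext (evalSph_injOn_homogeneous p.2.1 hp)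
    have hle : (LinearMap.range ((evalSphₗ q).domRestrict (harmPoly q l))) ≤
        Submodule.span ℝ (((Finset.range k).filter fun i => deg i = l).image y : Set _) := by
      rintro _ ⟨p, rfl⟩
      have := hy.spans l (evalSph p.1) ⟨p.1, p.2.1, by
        rw [← laplacianPoly_apply]; exact p.2.2, rfl⟩
      refine Submodule.span_mono ?_ this
      rintro _ ⟨i, hi, rfl⟩
      simp only [Finset.coe_image, Finset.coe_filter, Finset.mem_range]
      exact ⟨i, ⟨hlt i (by rw [hi]; omega), hi⟩, rfl⟩
    rw [← LinearMap.finrank_range_of_inj hinj]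
    exact (Submodule.finrank_mono hle).trans
      ((finrank_span_finset_le_card _).trans Finset.card_image_le)
  have h1 := (choose_add_choose_le_sum_finrank q n).trans (Finset.sum_le_sum hcard)
  have h2 : ∑ l ∈ Finset.range (n + 2), ((Finset.range k).filter fun i => deg i = l).card ≤ k := by
    rw [← Finset.card_biUnion]
    · refine (Finset.card_le_card (Finset.biUnion_subset.2 fun l _ => Finset.filter_subset _ _)).trans ?_
      simp
    · intro a _ b _ hab
      exact Finset.disjoint_filter.2 fun i _ h h' => hab (h.symm.trans h')
  have := harmDim_succ_le q n
  omega

theorem IsHarmonicBasis.apply_mem_piSub {deg : ℕ → ℕ} {y : ℕ → Sph q → ℝ}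
    (hy : IsHarmonicBasis q deg y) {n : ℕ} (hn : 1 ≤ n) {k : ℕ} (hk : k < harmDim (q + 1) n) :
    y k ∈ piSub q n := by
  obtain ⟨p, hp, -, h⟩ := hy.mem k
  exact homSph_le_piSub (hy.deg_le hn hk) ⟨p, hp, h.symm⟩

end Dimension

/-! ### Gram matrix and least squares weights -/

section LeastSquares

open Matrix

variable {q : ℕ}

theorem integral_eq_sum_of_support {C : Finset (Sph q)} {ν : Measure (Sph q)} [IsFiniteMeasure ν]
    (hC : ν (C : Set (Sph q))ᶜ = 0) {f : Sph q → ℝ} (hf : Continuous f) :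
    ∫ x, f x ∂ν = ∑ ξ ∈ C, ν.real {ξ} * f ξ := by
  have h : ν.restrict (C : Set (Sph q)) = ν := Measure.restrict_eq_self_of_ae_mem hC
  conv_lhs => rw [← h]
  rw [setIntegral_finset C (Continuous.integrable_of_compactSpace hf).integrableOn]
  simp

theorem discNorm_two_sq {C : Finset (Sph q)} {v : Sph q → ℝ} (hv : ∀ ξ, 0 ≤ v ξ) (f : Sph q → ℝ) :
    discNorm C v 2 f ^ 2 = ∑ ξ ∈ C, v ξ * f ξ ^ 2 := by
  have h : ∑ ξ ∈ C, v ξ * |f ξ| ^ (2 : ENNReal).toReal = ∑ ξ ∈ C, v ξ * f ξ ^ 2 := by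
    refine Finset.sum_congr rfl fun ξ _ => ?_
    rw [ENNReal.toReal_ofNat, Real.rpow_ofNat, sq_abs]
  have h0 : 0 ≤ ∑ ξ ∈ C, v ξ * f ξ ^ 2 :=
    Finset.sum_nonneg fun ξ _ => mul_nonneg (hv ξ) (sq_nonneg _)
  rw [discNorm, if_neg (by simp), h, ENNReal.toReal_ofNat, ← Real.sqrt_eq_rpow, Real.sq_sqrt h0]

theorem discNorm_nonneg {C : Finset (Sph q)} {v : Sph q → ℝ} (hv : ∀ ξ, 0 ≤ v ξ) {p : ENNReal}
    (hp : p ≠ ⊤) (f : Sph q → ℝ) : 0 ≤ discNorm C v p f := by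
  rw [discNorm, if_neg hp]
  exact Real.rpow_nonneg (Finset.sum_nonneg fun ξ _ =>
    mul_nonneg (hv ξ) (Real.rpow_nonneg (abs_nonneg _) _)) _

theorem sphNorm_two_sq {f : Sph q → ℝ} (hf : Continuous f) :
    sphNorm 2 f ^ 2 = ∫ x, f x ^ 2 ∂(muSph q) := by
  have hm : MemLp f 2 (muSph q) := by
    rw [memLp_two_iff_integrable_sq hf.aestronglyMeasurable]
    exact Continuous.integrable_of_compactSpace (hf.pow 2)
  have h0 : 0 ≤ ∫ x, f x ^ 2 ∂(muSph q) := integral_nonneg fun x => sq_nonneg _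
  rw [sphNorm, hm.eLpNorm_eq_integral_rpow_norm two_ne_zero ENNReal.ofNat_ne_top]
  simp only [ENNReal.toReal_ofNat, Real.rpow_ofNat, Real.norm_eq_abs, sq_abs]
  rw [ENNReal.toReal_ofReal (Real.rpow_nonneg h0 _), ← one_div, ← Real.sqrt_eq_rpow,
    Real.sq_sqrt h0]

theorem TwoSidedMZ.integral_bounds {n : ℕ} {C : Finset (Sph q)} {ν : Measure (Sph q)}
    [IsFiniteMeasure ν] (hC : ν (C : Set (Sph q))ᶜ = 0) {c₁ c₂ : ℝ} (hc₁ : 0 < c₁)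
    (h : TwoSidedMZ n C (fun ξ => ν.real {ξ}) c₁ c₂ 2) {f : Sph q → ℝ} (hf : f ∈ piSub q n) :
    c₁ ^ 2 * ∫ x, f x ^ 2 ∂(muSph q) ≤ ∫ x, f x ^ 2 ∂ν ∧
      ∫ x, f x ^ 2 ∂ν ≤ c₂ ^ 2 * ∫ x, f x ^ 2 ∂(muSph q) := by
  have hcont := continuous_of_mem_piSub hf
  have hv : ∀ ξ : Sph q, 0 ≤ ν.real {ξ} := fun ξ => measureReal_nonneg
  rw [integral_eq_sum_of_support hC (f := fun x => f x ^ 2) (hcont.pow 2), ← discNorm_two_sq hv, ← sphNorm_two_sq hcont,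
    ← mul_pow, ← mul_pow]
  obtain ⟨h1, h2⟩ := h f (mem_piSub.1 hf)
  have h3 : 0 ≤ sphNorm 2 f := ENNReal.toReal_nonneg
  exact ⟨pow_le_pow_left₀ (by positivity) h1 2,
    pow_le_pow_left₀ (discNorm_nonneg hv ENNReal.ofNat_ne_top f) h2 2⟩

theorem one_mem_piSub (q n : ℕ) : (fun _ => 1 : Sph q → ℝ) ∈ piSub q n :=
  mem_piSub.2 ⟨1, by simp, by ext x; simp [evalSph]⟩

section Gram

variable {deg : ℕ → ℕ} {y : ℕ → Sph q → ℝ} {n : ℕ} {C : Finset (Sph q)}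
  {ν : Measure (Sph q)} [IsFiniteMeasure ν]

theorem IsHarmonicBasis.continuous (hy : IsHarmonicBasis q deg y) (k : ℕ) : Continuous (y k) := by
  obtain ⟨p, -, -, h⟩ := hy.mem k
  rw [h]; exact continuous_evalSph p

theorem IsHarmonicBasis.sum_mem_piSub (hy : IsHarmonicBasis q deg y) (hn : 1 ≤ n)
    (a : Fin (harmDim (q + 1) n) → ℝ) : (fun x => ∑ k, a k * y k x) ∈ piSub q n := by
  have : (fun x => ∑ k, a k * y k x) = ∑ k, a k • y k := by
    ext x; simp [Finset.sum_apply]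
  rw [this]
  exact Submodule.sum_mem _ fun k _ => Submodule.smul_mem _ _ (hy.apply_mem_piSub hn k.2)

theorem IsHarmonicBasis.integral_sq_sum_gram (hy : IsHarmonicBasis q deg y) {N : ℕ}
    (a : Fin N → ℝ) :
    ∫ x, (∑ k, a k * y k x) ^ 2 ∂ν = a ⬝ᵥ gramMat y ν N *ᵥ a :=
  integral_sq_sum ν (f := fun k : Fin N => y k) (fun k => hy.continuous k) a

theorem IsHarmonicBasis.integral_sq_sum_muSph (hy : IsHarmonicBasis q deg y) {N : ℕ}
    (a : Fin N → ℝ) :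
    ∫ x, (∑ k, a k * y k x) ^ 2 ∂(muSph q) = a ⬝ᵥ a :=
  integral_sq_sum_orthonormal (f := fun k : Fin N => y k) (fun k => hy.continuous k)
    (fun i j => by rw [hy.orthonormal]; simp [Fin.ext_iff]) a

omit [IsFiniteMeasure ν] in
theorem isSymm_gramMat (N : ℕ) : (gramMat y ν N)ᵀ = gramMat y ν N := by
  ext i j; simp [gramMat, mul_comm]

theorem IsHarmonicBasis.gram_bounds (hy : IsHarmonicBasis q deg y) (hn : 1 ≤ n)
    (hC : ν (C : Set (Sph q))ᶜ = 0) {c₁ c₂ : ℝ} (hc₁ : 0 < c₁)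
    (h : TwoSidedMZ n C (fun ξ => ν.real {ξ}) c₁ c₂ 2) (a : Fin (harmDim (q + 1) n) → ℝ) :
    c₁ ^ 2 * (a ⬝ᵥ a) ≤ a ⬝ᵥ gramMat y ν (harmDim (q + 1) n) *ᵥ a ∧
      a ⬝ᵥ gramMat y ν (harmDim (q + 1) n) *ᵥ a ≤ c₂ ^ 2 * (a ⬝ᵥ a) := by
  rw [← hy.integral_sq_sum_gram, ← hy.integral_sq_sum_muSph]
  exact h.integral_bounds hC hc₁ (hy.sum_mem_piSub hn a)

theorem dotProduct_self_pos {ι : Type*} [Fintype ι] {a : ι → ℝ} (ha : a ≠ 0) : 0 < a ⬝ᵥ a :=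
  lt_of_le_of_ne (Finset.sum_nonneg fun _ _ => mul_self_nonneg _)
    fun h => ha (dotProduct_self_eq_zero.1 h.symm)

theorem IsHarmonicBasis.posDef_gramMat (hy : IsHarmonicBasis q deg y) (hn : 1 ≤ n)
    (hC : ν (C : Set (Sph q))ᶜ = 0) {c₁ c₂ : ℝ} (hc₁ : 0 < c₁)
    (h : TwoSidedMZ n C (fun ξ => ν.real {ξ}) c₁ c₂ 2) :
    (gramMat y ν (harmDim (q + 1) n)).PosDef := by
  refine Matrix.PosDef.of_dotProduct_mulVec_pos ?_ fun a ha => ?_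
  · rw [IsHermitian, conjTranspose_eq_transpose_of_trivial, isSymm_gramMat]
  · have := (hy.gram_bounds hn hC hc₁ h a).1
    have h2 := dotProduct_self_pos ha
    simp only [star_trivial]
    exact lt_of_lt_of_le (by positivity) this

theorem IsHarmonicBasis.eigenvalue_bounds (hy : IsHarmonicBasis q deg y) (hn : 1 ≤ n)
    (hC : ν (C : Set (Sph q))ᶜ = 0) {c₁ c₂ : ℝ} (hc₁ : 0 < c₁)
    (h : TwoSidedMZ n C (fun ξ => ν.real {ξ}) c₁ c₂ 2) {t : ℝ}
    (ht : Module.End.HasEigenvalue (Matrix.toLin' (gramMat y ν (harmDim (q + 1) n))) t) :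
    c₁ ^ 2 ≤ t ∧ t ≤ c₂ ^ 2 := by
  obtain ⟨a, ha⟩ := ht.exists_hasEigenvector
  have ha1 := ha.apply_eq_smul
  rw [Matrix.toLin'_apply] at ha1
  have hb := hy.gram_bounds hn hC hc₁ h a
  rw [ha1, dotProduct_smul, smul_eq_mul] at hb
  have hpos := dotProduct_self_pos ha.2
  exact ⟨le_of_mul_le_mul_right hb.1 hpos, le_of_mul_le_mul_right hb.2 hpos⟩

/-- The right-hand side `(1, 0, …, 0)` of the least squares problem. -/
noncomputable def firstVec (N : ℕ) : Fin N → ℝ := fun i => if (i : ℕ) = 0 then 1 else 0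

theorem firstVec_cases (N : ℕ) : firstVec N = 0 ∨ ∃ i : Fin N, (i : ℕ) = 0 ∧
    firstVec N = Pi.single i 1 := by
  rcases N with _ | N
  · exact Or.inl (funext fun i => i.elim0)
  · refine Or.inr ⟨0, rfl, ?_⟩
    ext i
    rw [firstVec, Pi.single_apply]
    exact if_congr (by rw [Fin.ext_iff]; rfl) rfl rfl

theorem firstVec_dotProduct_self_le (N : ℕ) : firstVec N ⬝ᵥ firstVec N ≤ 1 := by
  rcases firstVec_cases N with h | ⟨i, -, h⟩ <;> simp [h]

omit [IsFiniteMeasure ν] in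
theorem lsqWeight_eq (N : ℕ) (ξ : Sph q) :
    lsqWeight y ν N ξ = ν.real {ξ} * ∑ k : Fin N, ((gramMat y ν N)⁻¹ *ᵥ firstVec N) k * y k ξ :=
  rfl

/-- Cauchy–Schwarz for `∑ v_ξ |R(ξ)|`; the M–Z inequality for `p = 2` suffices, its upper half being
applied to the constant `1`. -/
theorem IsHarmonicBasis.sum_abs_lsqWeight_le (hy : IsHarmonicBasis q deg y) (hn : 1 ≤ n)
    (hC : ν (C : Set (Sph q))ᶜ = 0) {c₁ c₂ : ℝ} (hc₁ : 0 < c₁) (hc₂ : 0 < c₂)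
    (h : TwoSidedMZ n C (fun ξ => ν.real {ξ}) c₁ c₂ 2) :
    ∑ ξ ∈ C, |lsqWeight y ν (harmDim (q + 1) n) ξ| ≤ c₂ / c₁ := by
  set N := harmDim (q + 1) n
  set G := gramMat y ν N
  set e := firstVec N
  set b := G⁻¹ *ᵥ e with hb
  have hGb : G *ᵥ b = e := by
    rw [hb, mulVec_mulVec, Matrix.mul_nonsing_inv _
      ((Matrix.isUnit_iff_isUnit_det _).1 (hy.posDef_gramMat hn hC hc₁ h).isUnit), one_mulVec]
  set R : Sph q → ℝ := fun x => ∑ k, b k * y k x with hR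
  have hRm : R ∈ piSub q n := hy.sum_mem_piSub hn b
  have hRν : ∑ ξ ∈ C, ν.real {ξ} * R ξ ^ 2 = b ⬝ᵥ e := by
    rw [← hGb, ← hy.integral_sq_sum_gram (ν := ν) b,
      integral_eq_sum_of_support hC (f := fun x => R x ^ 2) ((continuous_of_mem_piSub hRm).pow 2)]
  -- From `c₁² |b|² ≤ b · e` and `(b · e)² ≤ |b|²`.
  have hbe : b ⬝ᵥ e ≤ (c₁ ^ 2)⁻¹ := by
    have h1 := (hy.gram_bounds hn hC hc₁ h b).1
    rw [hGb] at h1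
    have h2 := (sq_dotProduct_le b e).trans (mul_le_of_le_one_right
      (Finset.sum_nonneg fun i _ => mul_self_nonneg _) (firstVec_dotProduct_self_le N))
    rcases le_or_gt (b ⬝ᵥ e) 0 with h0 | h0
    · exact h0.trans (by positivity)
    · rw [← one_div, le_div_iff₀ (by positivity)]
      refine le_of_mul_le_mul_left ?_ h0
      nlinarith [mul_le_mul_of_nonneg_left h2 (sq_nonneg c₁)]
  have hv1 : ∑ ξ ∈ C, ν.real {ξ} ≤ c₂ ^ 2 := by
    have := (h.integral_bounds hC hc₁ (one_mem_piSub q n)).2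
    rw [integral_eq_sum_of_support hC (by fun_prop)] at this
    simpa using this
  have hsum : ∑ ξ ∈ C, |lsqWeight y ν N ξ| = ∑ ξ ∈ C, √(ν.real {ξ}) * (√(ν.real {ξ}) * |R ξ|) := by
    refine Finset.sum_congr rfl fun ξ _ => ?_
    rw [lsqWeight_eq, abs_mul, abs_of_nonneg measureReal_nonneg, ← mul_assoc,
      Real.mul_self_sqrt measureReal_nonneg]
  have hcs := Finset.sum_mul_sq_le_sq_mul_sq C (fun ξ => √(ν.real {ξ}))
    fun ξ => √(ν.real {ξ}) * |R ξ|
  simp only [mul_pow, sq_abs, Real.sq_sqrt measureReal_nonneg] at hcs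
  rw [← hsum, hRν] at hcs
  refine (sq_le_sq₀ (Finset.sum_nonneg fun ξ _ => abs_nonneg _) (by positivity)).1 ?_
  calc _ ≤ _ := hcs
    _ ≤ c₂ ^ 2 * (c₁ ^ 2)⁻¹ := mul_le_mul hv1 hbe
        (hRν ▸ Finset.sum_nonneg fun ξ _ => mul_nonneg measureReal_nonneg (sq_nonneg _)) (sq_nonneg _)
    _ = _ := by rw [div_pow, div_eq_mul_inv]

/-- The polynomial behind the weights is a perturbation of the constant `1`: its coefficient error
is `O(n^(-q))` in `L²`, and passing to the uniform norm costs only `n^(q/2)`. -/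
theorem IsHarmonicBasis.abs_lsqWeight_le (hy : IsHarmonicBasis q deg y) (hn : 1 ≤ n)
    (hC : ν (C : Set (Sph q))ᶜ = 0) {c₁ c₂ κ : ℝ} (hc₁ : 0 < c₁) (hκ : 0 < κ)
    (h : TwoSidedMZ n C (fun ξ => ν.real {ξ}) c₁ c₂ 2) (hs : StrongMZ n κ ν) (ξ : Sph q) :
    |lsqWeight y ν (harmDim (q + 1) n) ξ| ≤ (1 + √(2 ^ (q + 1)) * κ / c₁ ^ 2) * ν.real {ξ} := by
  set N := harmDim (q + 1) n
  set G := gramMat y ν N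
  set e := firstVec N
  set b := G⁻¹ *ᵥ e with hb
  have hGb : G *ᵥ b = e := by
    rw [hb, mulVec_mulVec, Matrix.mul_nonsing_inv _
      ((Matrix.isUnit_iff_isUnit_det _).1 (hy.posDef_gramMat hn hC hc₁ h).isUnit), one_mulVec]
  set d := b - e with hd
  have hbd : b = d + e := by simp [hd]
  have hn' : (0 : ℝ) < n := by exact_mod_cast hn
  set δ : ℝ := κ / (n : ℝ) ^ q with hδ
  have hδ0 : 0 < δ := by positivity
  have hdisc : ∀ a : Fin N → ℝ, |a ⬝ᵥ G *ᵥ a - a ⬝ᵥ a| ≤ δ * (a ⬝ᵥ a) := fun a => by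
    have := hs _ (mem_piSub.1 (hy.sum_mem_piSub hn a))
    rwa [sqDisc, hy.integral_sq_sum_gram, hy.integral_sq_sum_muSph] at this
  -- Polarisation turns the bound for the quadratic form of `G - 1` into one for its bilinear form.
  have hpol : ∀ x z : Fin N → ℝ, 2 * |x ⬝ᵥ G *ᵥ z - x ⬝ᵥ z| ≤ δ * (x ⬝ᵥ x + z ⬝ᵥ z) := by
    intro x z
    have hsymm : z ⬝ᵥ G *ᵥ x = x ⬝ᵥ G *ᵥ z := by
      rw [dotProduct_mulVec, ← mulVec_transpose, isSymm_gramMat, dotProduct_comm]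
    have h1 := abs_le.1 (hdisc (x + z))
    have h2 := abs_le.1 (hdisc (x - z))
    simp only [mulVec_add, mulVec_sub, dotProduct_add, add_dotProduct, dotProduct_sub,
      sub_dotProduct, hsymm, dotProduct_comm z x] at h1 h2
    rw [← abs_of_pos (two_pos : (0 : ℝ) < 2), ← abs_mul, abs_le]
    constructor <;> linarith [h1.1, h1.2, h2.1, h2.2]
  have hdd : d ⬝ᵥ d ≤ (δ / c₁ ^ 2) ^ 2 := by
    have h1 := (hy.gram_bounds hn hC hc₁ h d).1
    have h2 : d ⬝ᵥ G *ᵥ d = -(d ⬝ᵥ G *ᵥ e - d ⬝ᵥ e) := by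
      conv_lhs => rw [hd, mulVec_sub, hGb, dotProduct_sub]
      ring
    -- Scaling `d` balances the two squares in the polarised bound: `τ` is the reciprocal of the
    -- expected size `δ / c₁²` of `d`.
    set τ := c₁ ^ 2 / δ with hτ
    have hτ0 : 0 < τ := by positivity
    have h3 := hpol (τ • d) e
    simp only [smul_dotProduct, dotProduct_smul, smul_eq_mul, ← mul_sub, abs_mul,
      abs_of_pos hτ0] at h3
    have h4 := firstVec_dotProduct_self_le N
    have h5 : c₁ ^ 2 * (d ⬝ᵥ d) ≤ |d ⬝ᵥ G *ᵥ e - d ⬝ᵥ e| :=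
      (h1.trans_eq h2).trans (neg_le_abs _)
    have h6 : 2 * (τ * (c₁ ^ 2 * (d ⬝ᵥ d))) ≤ δ * (τ * (τ * (d ⬝ᵥ d)) + 1) := by
      refine le_trans ?_ (h3.trans ?_) <;> gcongr
    have h7 : c₁ ^ 2 = τ * δ := by rw [hτ]; field_simp
    have h8 : δ / c₁ ^ 2 = 1 / τ := by rw [hτ]; field_simp
    rw [h7] at h6
    rw [h8, div_pow, one_pow, le_div_iff₀ (by positivity)]
    have h9 : δ * (τ ^ 2 * (d ⬝ᵥ d)) ≤ δ * 1 := by linarith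
    linarith [le_of_mul_le_mul_left h9 hδ0]
  set F : Sph q → ℝ := fun x => ∑ k, d k * y k x with hF
  have hFx : |F ξ| ≤ √(2 ^ (q + 1)) * κ / c₁ ^ 2 := by
    refine abs_le_of_sq_le_sq ?_ (by positivity)
    have h1 := sq_le_finrank_mul_integral hn (hy.sum_mem_piSub hn d) ξ
    rw [hy.integral_sq_sum_muSph] at h1
    have h2 : (Module.finrank ℝ (piSub q n) : ℝ) ≤ 2 ^ (q + 1) * n ^ q := by
      exact_mod_cast finrank_piSub_le q hn
    have hnq : (1 : ℝ) ≤ (n : ℝ) ^ q := one_le_pow₀ (by exact_mod_cast hn)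
    calc F ξ ^ 2 ≤ _ := h1
      _ ≤ 2 ^ (q + 1) * n ^ q * (δ / c₁ ^ 2) ^ 2 :=
          mul_le_mul h2 hdd (Finset.sum_nonneg fun i _ => mul_self_nonneg _) (by positivity)
      _ = 2 ^ (q + 1) * κ ^ 2 / (c₁ ^ 2) ^ 2 / n ^ q := by rw [hδ]; field_simp
      _ ≤ 2 ^ (q + 1) * κ ^ 2 / (c₁ ^ 2) ^ 2 := div_le_self (by positivity) hnq
      _ = _ := by rw [div_pow, mul_pow, Real.sq_sqrt (by positivity)]
  have he1 : |∑ k, e k * y k ξ| ≤ 1 := by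
    rcases firstVec_cases N with h0 | ⟨i, hi, h0⟩
    · simp [e, h0]
    · simp [e, h0, Pi.single_apply, hi, hy.first]
  rw [lsqWeight_eq, abs_mul, abs_of_nonneg measureReal_nonneg, mul_comm]
  refine mul_le_mul_of_nonneg_right ?_ measureReal_nonneg
  have : ∑ k, b k * y k ξ = F ξ + ∑ k, e k * y k ξ := by
    simp [hF, hbd, add_mul, Finset.sum_add_distrib]
  change |∑ k, b k * y k ξ| ≤ _
  rw [this]
  linarith [abs_add_le (F ξ) (∑ k, e k * y k ξ)]

end Gram

/-- Since `K ≥ 1`, the natural constant `K^(1/p)` is at most `K`, uniformly in `p`. -/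
theorem discNorm_le_of_le {C : Finset (Sph q)} {v w : Sph q → ℝ} {K : ℝ} (hK : 1 ≤ K)
    (hv : ∀ ξ, 0 ≤ v ξ) (hw : ∀ ξ, 0 ≤ w ξ) (hwv : ∀ ξ ∈ C, w ξ ≤ K * v ξ) {p : ENNReal}
    (hp : 1 ≤ p) (hpt : p ≠ ⊤) (f : Sph q → ℝ) :
    discNorm C w p f ≤ K * discNorm C v p f := by
  have hp1 : 1 ≤ p.toReal := by
    simpa using ENNReal.toReal_mono hpt hp
  have hnn : ∀ ξ, 0 ≤ |f ξ| ^ p.toReal := fun ξ => Real.rpow_nonneg (abs_nonneg _) _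
  have hS : 0 ≤ ∑ ξ ∈ C, v ξ * |f ξ| ^ p.toReal :=
    Finset.sum_nonneg fun ξ _ => mul_nonneg (hv ξ) (hnn ξ)
  rw [discNorm, discNorm, if_neg hpt, if_neg hpt]
  calc (∑ ξ ∈ C, w ξ * |f ξ| ^ p.toReal) ^ (1 / p.toReal)
      ≤ (K * ∑ ξ ∈ C, v ξ * |f ξ| ^ p.toReal) ^ (1 / p.toReal) := by
        refine Real.rpow_le_rpow (Finset.sum_nonneg fun ξ _ => mul_nonneg (hw ξ) (hnn ξ)) ?_
          (by positivity)
        rw [Finset.mul_sum]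
        refine Finset.sum_le_sum fun ξ hξ => ?_
        rw [← mul_assoc]
        exact mul_le_mul_of_nonneg_right (hwv ξ hξ) (hnn ξ)
    _ = K ^ (1 / p.toReal) * (∑ ξ ∈ C, v ξ * |f ξ| ^ p.toReal) ^ (1 / p.toReal) :=
        Real.mul_rpow (by linarith) hS
    _ ≤ K * _ := by
        refine mul_le_mul_of_nonneg_right ?_ (Real.rpow_nonneg hS _)
        calc K ^ (1 / p.toReal) ≤ K ^ (1 : ℝ) :=
              Real.rpow_le_rpow_of_exponent_le hK (by
                rw [div_le_one (by linarith)]; exact hp1)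
          _ = K := Real.rpow_one K

end LeastSquares

/-! ### Random points -/

section Sampling

open Matrix

variable {q : ℕ}

theorem integral_empMeasure {M : ℕ} (x : Fin M → Sph q) {f : Sph q → ℝ} (hf : Continuous f) :
    ∫ z, f z ∂(empMeasure x) = (M : ℝ)⁻¹ * ∑ j, f (x j) := by
  rw [empMeasure, integral_smul_measure, integral_finsetSum_measure fun j _ =>
    Continuous.integrable_of_compactSpace hf]
  simp

/-- The probability that a random sample is a bad quadrature rule for squares. -/
theorem measure_sqDisc_ge_le {n M : ℕ} (hn : 1 ≤ n) (hM : 1 ≤ M) {η : ℝ} (hη : 0 < η) (hη1 : η ≤ 1)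
    {Ω : Type*} [MeasurableSpace Ω] (ℙ : Measure Ω) [IsProbabilityMeasure ℙ]
    (X : Fin M → Ω → Sph q) (hX : ∀ j, Measurable (X j))
    (hind : ProbabilityTheory.iIndepFun X ℙ) (hlaw : ∀ j, ℙ.map (X j) = muSph q) :
    ℙ.real {ω | ∃ P ∈ PiSph q n, P ≠ 0 ∧
        η * ∫ x, P x ^ 2 ∂(muSph q) ≤ sqDisc (empMeasure fun j => X j ω) P} ≤
      2 * (Module.finrank ℝ (piSub q n) *
        Real.exp (-(η ^ 2 * M / (8 * Module.finrank ℝ (piSub q n))))) := by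
  set D := Module.finrank ℝ (piSub q n)
  have hD : (1 : ℝ) ≤ D := by exact_mod_cast finrank_piSub_pos q hn
  obtain ⟨e, he, ho, hspan⟩ := exists_orthonormal_piSub q hn
  have hc : ∀ i, Continuous (e i) := fun i => continuous_of_mem_piSub (he i)
  set Y : Sph q → Fin D → ℝ := fun x i => e i x with hY
  have hYc : Continuous Y := continuous_pi hc
  have hYD : ∀ x, Y x ⬝ᵥ Y x ≤ D := fun x => by
    rw [← sum_sq_eq_finrank hn he ho hspan x]
    exact le_of_eq (Finset.sum_congr rfl fun i _ => (sq _).symm)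
  have h1 := measure_upper_deviation_le (muSph q) hYc ho (by linarith) hYD hM hη hη1
  have h2 := measure_lower_deviation_le (muSph q) hYc ho hD hYD hM hη hη1
  rw [Fintype.card_fin] at h1 h2
  set S₁ := {x : Fin M → Sph q | ∃ a : Fin D → ℝ, a ≠ 0 ∧
      (1 + η) * (a ⬝ᵥ a) ≤ (M : ℝ)⁻¹ * ∑ j, (Y (x j) ⬝ᵥ a) ^ 2}
  set S₂ := {x : Fin M → Sph q | ∃ a : Fin D → ℝ, a ≠ 0 ∧
      (M : ℝ)⁻¹ * ∑ j, (Y (x j) ⬝ᵥ a) ^ 2 ≤ (1 - η) * (a ⬝ᵥ a)}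
  have hmap : ℙ.map (fun ω j => X j ω) = Measure.pi fun _ : Fin M => muSph q := by
    rw [(ProbabilityTheory.iIndepFun_iff_map_fun_eq_pi_map fun j => (hX j).aemeasurable).1 hind]
    simp_rw [hlaw]
  have hXm : Measurable fun ω j => X j ω := measurable_pi_lambda _ hX
  have hsub : {ω | ∃ P ∈ PiSph q n, P ≠ 0 ∧
        η * ∫ x, P x ^ 2 ∂(muSph q) ≤ sqDisc (empMeasure fun j => X j ω) P} ⊆
      (fun ω j => X j ω) ⁻¹' (S₁ ∪ S₂) := by
    rintro ω ⟨P, hP, hP0, hPη⟩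
    have hP := mem_piSub.2 hP
    obtain ⟨a, ha⟩ := hspan P hP
    have ha0 : a ≠ 0 := by
      rintro rfl
      exact hP0 (funext fun x => by simp [ha x])
    have hPμ : ∫ x, P x ^ 2 ∂(muSph q) = a ⬝ᵥ a := by
      simp_rw [ha]
      exact integral_sq_sum_orthonormal hc ho a
    have hPν : ∫ x, P x ^ 2 ∂(empMeasure fun j => X j ω) =
        (M : ℝ)⁻¹ * ∑ j, (Y (X j ω) ⬝ᵥ a) ^ 2 := by
      rw [integral_empMeasure _ (f := fun x => P x ^ 2) ((continuous_of_mem_piSub hP).pow 2)]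
      congr 1
      refine Finset.sum_congr rfl fun j _ => ?_
      rw [ha, dotProduct_comm]; rfl
    rw [sqDisc, hPμ, hPν, le_abs] at hPη
    rcases hPη with h | h
    · exact Or.inl ⟨a, ha0, by linarith⟩
    · exact Or.inr ⟨a, ha0, by linarith⟩
  calc _ ≤ ℙ.real ((fun ω j => X j ω) ⁻¹' (S₁ ∪ S₂)) := measureReal_mono hsub
    _ ≤ (Measure.pi fun _ : Fin M => muSph q).real (S₁ ∪ S₂) := by
        rw [← hmap]
        have : IsProbabilityMeasure (ℙ.map fun ω j => X j ω) := by rw [hmap]; infer_instance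
        -- The deviation events are not shown to be measurable; this inequality holds for arbitrary
        -- sets.
        exact ENNReal.toReal_mono (measure_ne_top _ _) (Measure.le_map_apply hXm.aemeasurable _)
    _ ≤ _ := (measureReal_union_le _ _).trans (by linarith)

/-- The failure probability for a sample of size proportional to `n^q log n / η²`. -/
theorem measure_sqDisc_ge_le_rpow {n M : ℕ} (hn : 2 ≤ n) (hM : 1 ≤ M) {A η : ℝ} (hA : 0 < A)
    (hη : 0 < η) (hMn : 2 ^ (q + 4) * (A + q) * (n : ℝ) ^ q * Real.log n ≤ M)
    (hMη : 2 ^ (q + 4) * (A + q) * (n : ℝ) ^ q * Real.log n / η ^ 2 ≤ M)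
    {Ω : Type*} [MeasurableSpace Ω] (ℙ : Measure Ω) [IsProbabilityMeasure ℙ]
    (X : Fin M → Ω → Sph q) (hX : ∀ j, Measurable (X j))
    (hind : ProbabilityTheory.iIndepFun X ℙ) (hlaw : ∀ j, ℙ.map (X j) = muSph q) :
    ℙ.real {ω | ∃ P ∈ PiSph q n, P ≠ 0 ∧
        η * ∫ x, P x ^ 2 ∂(muSph q) ≤ sqDisc (empMeasure fun j => X j ω) P} ≤
      2 ^ (q + 2) * (n : ℝ) ^ (-A) := by
  have hn0 : (0 : ℝ) < n := by exact_mod_cast (by omega : 0 < n)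
  have hn1 : 1 ≤ n := by omega
  -- The tail bounds require `η ≤ 1`; the two lower bounds on `M` cover the two cases of the
  -- minimum.
  set η' := min η 1 with hη'
  have hη'0 : 0 < η' := lt_min hη one_pos
  have hMη' : 2 ^ (q + 4) * (A + q) * (n : ℝ) ^ q * Real.log n ≤ η' ^ 2 * M := by
    rcases min_choice η 1 with h | h <;> rw [hη', h]
    · rw [div_le_iff₀ (by positivity)] at hMη; linarith
    · linarith
  set D := Module.finrank ℝ (piSub q n)
  have hD1 : (1 : ℝ) ≤ D := by exact_mod_cast finrank_piSub_pos q hn1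
  have hD : (D : ℝ) ≤ 2 ^ (q + 1) * n ^ q := by exact_mod_cast finrank_piSub_le q hn1
  have hlog : 0 ≤ Real.log n := Real.log_natCast_nonneg n
  -- The extra `q` in the exponent absorbs the factor `D = O(n^q)` of the tail bounds, and `2^(q+4)`
  -- is `8 · 2^(q+1)`.
  have hexp : Real.exp (-(η' ^ 2 * M / (8 * D))) ≤ (n : ℝ) ^ (-(A + q)) := by
    rw [Real.rpow_def_of_pos hn0]
    refine Real.exp_le_exp.2 ?_
    rw [mul_neg, neg_le_neg_iff, le_div_iff₀ (by positivity)]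
    calc Real.log n * (A + q) * (8 * D) ≤ Real.log n * (A + q) * (8 * (2 ^ (q + 1) * n ^ q)) := by
          gcongr
      _ = 2 ^ (q + 4) * (A + q) * (n : ℝ) ^ q * Real.log n := by ring
      _ ≤ _ := hMη'
  have hsub : {ω | ∃ P ∈ PiSph q n, P ≠ 0 ∧
        η * ∫ x, P x ^ 2 ∂(muSph q) ≤ sqDisc (empMeasure fun j => X j ω) P} ⊆
      {ω | ∃ P ∈ PiSph q n, P ≠ 0 ∧
        η' * ∫ x, P x ^ 2 ∂(muSph q) ≤ sqDisc (empMeasure fun j => X j ω) P} := by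
    rintro ω ⟨P, hP, hP0, h⟩
    exact ⟨P, hP, hP0, (mul_le_mul_of_nonneg_right (min_le_left _ _)
      (integral_nonneg fun x => sq_nonneg _)).trans h⟩
  calc _ ≤ _ := measureReal_mono hsub
    _ ≤ _ := measure_sqDisc_ge_le hn1 hM hη'0 (min_le_right _ _) ℙ X hX hind hlaw
    _ ≤ 2 * (2 ^ (q + 1) * n ^ q * (n : ℝ) ^ (-(A + q))) := by gcongr
    _ = _ := by
        rw [neg_add, Real.rpow_add hn0, Real.rpow_neg hn0.le (q : ℝ), Real.rpow_natCast]
        field_simp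
        ring

end Sampling

/-! ### Choice of the constants -/

theorem theorem4p1 (q : ℕ) (hq : 1 ≤ q) :
    -- (a), the spectrum of the Gram matrix: only the constants for `p = 2` matter
    (∀ c₁ c₂ : ℝ, 0 < c₁ → 0 < c₂ →
      ∀ (deg : ℕ → ℕ) (y : ℕ → Sph q → ℝ), IsHarmonicBasis q deg y →
      ∀ n : ℕ, 1 ≤ n → ∀ (C : Finset (Sph q)) (ν : Measure (Sph q)) [IsFiniteMeasure ν],
        ν (C : Set (Sph q))ᶜ = 0 →
        TwoSidedMZ n C (fun ξ => ν.real {ξ}) c₁ c₂ 2 →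
        (∀ t : ℝ,
          Module.End.HasEigenvalue (Matrix.toLin' (gramMat y ν (harmDim (q + 1) n))) t →
            c₁ ^ 2 ≤ t ∧ t ≤ c₂ ^ 2) ∧
        (gramMat y ν (harmDim (q + 1) n)).PosDef) ∧
    -- (a), bounded variation of the least squares weights
    (∀ c₁ c₂ : ℝ, 0 < c₁ → 0 < c₂ → ∃ c : ℝ, 0 < c ∧
      ∀ (deg : ℕ → ℕ) (y : ℕ → Sph q → ℝ), IsHarmonicBasis q deg y →
      ∀ n : ℕ, 1 ≤ n → ∀ (C : Finset (Sph q)) (ν : Measure (Sph q)) [IsFiniteMeasure ν],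
        ν (C : Set (Sph q))ᶜ = 0 →
        (∀ p : ENNReal, 1 ≤ p → TwoSidedMZ n C (fun ξ => ν.real {ξ}) c₁ c₂ p) →
        ∑ ξ ∈ C, |lsqWeight y ν (harmDim (q + 1) n) ξ| ≤ c) ∧
    -- (b)
    (∀ c₁ c₂ κ : ℝ, 0 < c₁ → 0 < c₂ → 0 < κ → ∃ c : ℝ, 0 < c ∧
      ∀ (deg : ℕ → ℕ) (y : ℕ → Sph q → ℝ), IsHarmonicBasis q deg y →
      ∀ n : ℕ, 1 ≤ n → ∀ (C : Finset (Sph q)) (ν : Measure (Sph q)) [IsFiniteMeasure ν],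
        ν (C : Set (Sph q))ᶜ = 0 →
        (∀ p : ENNReal, 1 ≤ p → TwoSidedMZ n C (fun ξ => ν.real {ξ}) c₁ c₂ p) →
        StrongMZ n κ ν →
        (∀ ξ ∈ C, |lsqWeight y ν (harmDim (q + 1) n) ξ| ≤ c * ν.real {ξ}) ∧
        (∀ p : ENNReal, 1 ≤ p → p ≠ ⊤ → ∀ P ∈ PiSph q n,
          discNorm C (fun ξ => |lsqWeight y ν (harmDim (q + 1) n) ξ|) p P
            ≤ c * sphNorm p P)) ∧
    -- (c)
    (∃ c₁ : ℝ, 0 < c₁ ∧ ∀ A : ℝ, 0 < A →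
      (∃ c : ℝ, 0 < c ∧ ∀ (η : ℝ), 0 < η → ∀ n M : ℕ, 2 ≤ n → 1 ≤ M →
        c * (n : ℝ) ^ q * Real.log n ≤ M →
        c * (n : ℝ) ^ q * Real.log n / η ^ 2 ≤ M →
        ∀ (Ω : Type*) [MeasurableSpace Ω] (ℙ : Measure Ω) [IsProbabilityMeasure ℙ]
          (X : Fin M → Ω → Sph q), (∀ j, Measurable (X j)) →
          ProbabilityTheory.iIndepFun X ℙ → (∀ j, ℙ.map (X j) = muSph q) →
          ℙ.real {ω | ∃ P ∈ PiSph q n, P ≠ 0 ∧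
              η * ∫ x, P x ^ 2 ∂(muSph q) ≤ sqDisc (empMeasure fun j => X j ω) P}
            ≤ c₁ * (n : ℝ) ^ (-A)) ∧
      (∀ κ : ℝ, 0 < κ → ∃ c : ℝ, 0 < c ∧ ∀ n M : ℕ, 2 ≤ n → 1 ≤ M →
        c * (n : ℝ) ^ (3 * q) * Real.log n ≤ M →
        ∀ (Ω : Type*) [MeasurableSpace Ω] (ℙ : Measure Ω) [IsProbabilityMeasure ℙ]
          (X : Fin M → Ω → Sph q), (∀ j, Measurable (X j)) →
          ProbabilityTheory.iIndepFun X ℙ → (∀ j, ℙ.map (X j) = muSph q) →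
          1 - c₁ * (n : ℝ) ^ (-A) <
            ℙ.real {ω | StrongMZ n κ (empMeasure fun j => X j ω)})) := by
  -- Twice the constant `2^(q+2)` of the failure bound, which makes the last inequality strict.
  refine ⟨?_, ?_, ?_, 2 ^ (q + 3), by positivity, fun A hA => ⟨?_, ?_⟩⟩
  · intro c₁ c₂ hc₁ _ deg y hy n hn C ν _ hC h
    exact ⟨fun t ht => hy.eigenvalue_bounds hn hC hc₁ h ht, hy.posDef_gramMat hn hC hc₁ h⟩
  · intro c₁ c₂ hc₁ hc₂
    exact ⟨c₂ / c₁, by positivity, fun deg y hy n hn C ν _ hC h =>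
      hy.sum_abs_lsqWeight_le hn hC hc₁ hc₂ (h 2 one_le_two)⟩
  · intro c₁ c₂ κ hc₁ hc₂ hκ
    set K := 1 + √(2 ^ (q + 1)) * κ / c₁ ^ 2 with hK
    have hK1 : 1 ≤ K := le_add_of_nonneg_right (by positivity)
    refine ⟨K * (1 + c₂), by positivity, fun deg y hy n hn C ν _ hC h hs => ?_⟩
    have hw := hy.abs_lsqWeight_le hn hC hc₁ hκ (h 2 one_le_two) hs
    refine ⟨fun ξ _ => (hw ξ).trans ?_, fun p hp hpt P hP => ?_⟩
    · exact mul_le_mul_of_nonneg_right (le_mul_of_one_le_right (by linarith) (by linarith))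
        measureReal_nonneg
    · have h0 : 0 ≤ sphNorm p P := ENNReal.toReal_nonneg
      calc _ ≤ K * discNorm C (fun ξ => ν.real {ξ}) p P :=
            discNorm_le_of_le hK1 (fun ξ => measureReal_nonneg) (fun ξ => abs_nonneg _)
              (fun ξ _ => hw ξ) hp hpt P
        _ ≤ K * (c₂ * sphNorm p P) := by gcongr; exact (h p hp P hP).2
        _ ≤ K * (1 + c₂) * sphNorm p P := by
            nlinarith [mul_nonneg (zero_le_one.trans hK1) h0]
  · refine ⟨2 ^ (q + 4) * (A + q), by positivity, ?_⟩
    intro η hη n M hn hM hMn hMη Ω _ ℙ _ X hX hind hlaw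
    refine (measure_sqDisc_ge_le_rpow hn hM hA hη hMn hMη ℙ X hX hind hlaw).trans ?_
    gcongr <;> norm_num
  · intro κ hκ
    set c := 2 ^ (q + 4) * (A + q) with hc
    have hc0 : 0 < c := by positivity
    -- With `η = κ / n^q` one has `η⁻² = n^(2q) / κ²`, hence the power `n^(3q)`; the summand `1`
    -- serves the sample size condition without `η`.
    refine ⟨c * (1 + (κ ^ 2)⁻¹), by positivity, ?_⟩
    intro n M hn hM hMn Ω _ ℙ _ X hX hind hlaw
    have hn0 : (0 : ℝ) < n := by exact_mod_cast (by omega : 0 < n)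
    have hn1 : (1 : ℝ) ≤ n := by exact_mod_cast (by omega : 1 ≤ n)
    have hlog : 0 ≤ Real.log n := Real.log_natCast_nonneg n
    have h1 : c * (n : ℝ) ^ q * Real.log n ≤ M := by
      refine le_trans ?_ hMn
      gcongr ?_ * ?_ * _
      · exact le_mul_of_one_le_right hc0.le (le_add_of_nonneg_right (by positivity))
      · exact pow_le_pow_right₀ hn1 (by omega)
    have h2 : c * (n : ℝ) ^ q * Real.log n / (κ / (n : ℝ) ^ q) ^ 2 ≤ M := by
      refine le_trans ?_ hMn
      calc _ = c * (κ ^ 2)⁻¹ * (n : ℝ) ^ (3 * q) * Real.log n := by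
            rw [mul_comm 3 q, pow_mul]; field_simp
        _ ≤ _ := by gcongr; linarith
    have h3 := measure_sqDisc_ge_le_rpow hn hM hA (by positivity) h1 h2 ℙ X hX hind hlaw
    set good := {ω | StrongMZ n κ (empMeasure fun j => X j ω)}
    set bad := {ω | ∃ P ∈ PiSph q n, P ≠ 0 ∧ κ / (n : ℝ) ^ q * ∫ x, P x ^ 2 ∂(muSph q) ≤
      sqDisc (empMeasure fun j => X j ω) P}
    -- A cover and subadditivity replace passing to complements, which would need measurability.
    have hcover : Set.univ ⊆ good ∪ bad := by
      intro ω _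
      by_cases hω : ω ∈ good
      · exact Or.inl hω
      · right
        simp only [good, StrongMZ, Set.mem_ofPred_eq, not_forall, not_le] at hω
        obtain ⟨P, hP, h⟩ := hω
        refine ⟨P, hP, ?_, h.le⟩
        rintro rfl
        simp [sqDisc] at h
    have h4 : 1 ≤ ℙ.real good + ℙ.real bad := by
      have := (measureReal_mono hcover (h₂ := measure_ne_top ℙ _)).trans (measureReal_union_le good bad)
      simpa using this
    have h5 : 0 < (n : ℝ) ^ (-A) := Real.rpow_pos_of_pos hn0 _
    have h6 : (2 : ℝ) ^ (q + 3) * (n : ℝ) ^ (-A) = 2 * (2 ^ (q + 2) * (n : ℝ) ^ (-A)) := by ring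
    have h7 : 0 < 2 ^ (q + 2) * (n : ℝ) ^ (-A) := by positivity
    linarith
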